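/- Let $T>0$, let $\Omega\subset\mathbb{R}^N$ be a bounded open set and $\Omega_T=(0,T)\times\Omega$. For functions of time put $$(a\ast g)(t)=\int_0^t a(t-\tau)g(\tau)\,d\tau,\qquad (a\overset{T}{\ast}g)(t)=\int_t^T a(\tau-t)g(\tau)\,d\tau .$$ Let $k\in L_{1,loc}([0,\infty))$ be nonnegative and nonincreasing on $(0,\infty)$, and let $l\in L_{1,loc}([0,\infty))$ satisfy $k\ast l=1$ almost everywhere on $(0,\infty)$. For $n\in\mathbb{N}$, $n\ge1$, let $h_n\in L_{1,loc}([0,\infty))$ be the resolvent kernel associated with $n\,l$, i.e. the solution of $h_n+n\,(h_n\ast l)=n\,l$ a.e. on $(0,\infty)$, and let $k_n=k\ast h_n$. Let $V=\mathring{H}^1_2(\Omega)$, the closure of $C_0^\infty(\Omega)$ in $H^1_2(\Omega)$ (Dirichlet case), or $V=H^1_2(\Omega)$ (Neumann case). Let $u_0\in L_2(\Omega)$, $f\in L_2(\Omega_T)$, $u\in L_2(\Omega_T)$, let $k\ast u\in C([0,T];L_2(\Omega))$ with $(k\ast u)|_{t=0}=0$, and let $w\in L_2((0,T);V)$ with $w\ge0$.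 Suppose that $(u,w)$ is a weak subsolution of $\partial_t(k\ast[u-u_0])-\Delta w\le f$ in the sense that for all $n\ge1$ and all $\psi\in V$ with $\psi\ge0$, $$\int_\Omega\Big(\psi\,\partial_t\big(k_n\ast[u-u_0]\big)+(h_n\ast\nabla w)\cdot\nabla\psi\Big)\,dx\le\int_\Omega(h_n\ast f)\,\psi\,dx\qquad\text{for a.a. }t\in(0,T).$$ Then $\int_0^T\int_\Omega[k(T-t)+k(t)]\,|l\overset{T}{\ast}\nabla w|^2\,dx\,dt<\infty$ and $$\int_0^T\!\int_\Omega wu\,dx\,dt+\frac12\int_0^T\!\int_\Omega\big[k(T-t)+k(t)\big]\,\big|l\overset{T}{\ast}\nabla w\big|^2\,dx\,dt\le\int_0^T\!\int_\Omega\big(u_0+l\ast f\big)\,w\,dx\,dt .$$ -/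

import Mathlib

open MeasureTheory Set Filter
open scoped ContDiff Gradient

/-- The convolution `(a ∗ g)(t) = ∫₀ᵗ a(t - τ) g(τ) dτ` on the positive half-line. -/
noncomputable def timeConv {F : Type*} [NormedAddCommGroup F] [NormedSpace ℝ F]
    (a : ℝ → ℝ) (g : ℝ → F) (t : ℝ) : F :=
  ∫ τ in (0 : ℝ)..t, a (t - τ) • g τ

/-- The dual convolution `(a ⋆_T g)(t) = ∫ₜᵀ a(τ - t) g(τ) dτ` on the interval `(0, T)`. -/
noncomputable def dualTimeConv {F : Type*} [NormedAddCommGroup F] [NormedSpace ℝ F]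
    (T : ℝ) (a : ℝ → ℝ) (g : ℝ → F) (t : ℝ) : F :=
  ∫ τ in t..T, a (τ - t) • g τ

/-- `(k, l) ∈ PC`: `k` is locally integrable on `[0, ∞)`, nonnegative and nonincreasing, `l` is
locally integrable on `[0, ∞)`, and `k ∗ l = 1` almost everywhere on `(0, ∞)`. -/
structure IsPCPair (k l : ℝ → ℝ) : Prop where
  locallyIntegrable_k : LocallyIntegrableOn k (Ici 0)
  nonneg_k : ∀ t, 0 < t → 0 ≤ k t
  antitone_k : AntitoneOn k (Ioi 0)
  locallyIntegrable_l : LocallyIntegrableOn l (Ici 0)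
  conv_eq_one : ∀ᵐ t ∂(volume.restrict (Ioi (0 : ℝ))), timeConv k l t = 1

/-- `h` is the resolvent kernel associated with `γ l`: the (almost everywhere unique) locally
integrable solution of `h + γ (h ∗ l) = γ l` on `(0, ∞)`. -/
structure IsResolventKernel (γ : ℝ) (l h : ℝ → ℝ) : Prop where
  locallyIntegrable : LocallyIntegrableOn h (Ici 0)
  equation : ∀ᵐ t ∂(volume.restrict (Ioi (0 : ℝ))), h t + γ * timeConv h l t = γ * l t

/-- The Hilbert space `L₂(Ω; F)` for a subset `Ω` of `ℝᴺ`. -/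
abbrev L2 {N : ℕ} (Ω : Set (EuclideanSpace ℝ (Fin N)))
    (F : Type*) [NormedAddCommGroup F] : Type _ :=
  Lp F 2 (volume.restrict Ω)

/-- The space `C₀^∞(Ω)`. -/
def IsTestFunction {N : ℕ} (Ω : Set (EuclideanSpace ℝ (Fin N)))
    (φ : EuclideanSpace ℝ (Fin N) → ℝ) : Prop :=
  ContDiff ℝ ∞ φ ∧ HasCompactSupport φ ∧ tsupport φ ⊆ Ω

/-- The Sobolev space `H¹₂(Ω)`; an element `v` is stored as the pair `(v, ∇v)` consisting of the
function and its weak gradient. The norm of the product is equivalent to the usual one. -/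
def H1 {N : ℕ} (Ω : Set (EuclideanSpace ℝ (Fin N))) :
    Set (L2 Ω ℝ × L2 Ω (EuclideanSpace ℝ (Fin N))) :=
  {v | ∀ φ : EuclideanSpace ℝ (Fin N) → ℝ, IsTestFunction Ω φ →
    ∫ x in Ω, v.1 x • ∇ φ x = - ∫ x in Ω, φ x • v.2 x}

/-- The space `H̊¹₂(Ω)`: the closure of `C₀^∞(Ω)` in `H¹₂(Ω)`, again as pairs `(v, ∇v)`. -/
def H1zero {N : ℕ} (Ω : Set (EuclideanSpace ℝ (Fin N))) :
    Set (L2 Ω ℝ × L2 Ω (EuclideanSpace ℝ (Fin N))) :=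
  closure {v | ∃ φ : EuclideanSpace ℝ (Fin N) → ℝ, IsTestFunction Ω φ ∧
    (∀ᵐ x ∂(volume.restrict Ω), v.1 x = φ x) ∧ (∀ᵐ x ∂(volume.restrict Ω), v.2 x = ∇ φ x)}

/-- The two homogeneous boundary conditions. -/
inductive BoundaryCondition
  | dirichlet
  | neumann

/-- The space belonging to a boundary condition: `H̊¹₂(Ω)` for Dirichlet, `H¹₂(Ω)` for Neumann. -/
def BoundaryCondition.space {N : ℕ} (bc : BoundaryCondition)
    (Ω : Set (EuclideanSpace ℝ (Fin N))) :
    Set (L2 Ω ℝ × L2 Ω (EuclideanSpace ℝ (Fin N))) :=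
  match bc with
  | .dirichlet => H1zero Ω
  | .neumann => H1 Ω

/-- `w ∈ L₂((0,T); V)` for a set `V` of pairs `(v, ∇v)`. -/
def MemL2Time {N : ℕ} {Ω : Set (EuclideanSpace ℝ (Fin N))} (T : ℝ)
    (V : Set (L2 Ω ℝ × L2 Ω (EuclideanSpace ℝ (Fin N))))
    (w : ℝ → L2 Ω ℝ × L2 Ω (EuclideanSpace ℝ (Fin N))) : Prop :=
  MemLp w 2 (volume.restrict (Ioo 0 T)) ∧ ∀ᵐ t ∂(volume.restrict (Ioo 0 T)), w t ∈ V

/-- `k ∗ u` belongs to `C([0,T]; X)` and vanishes at `t = 0` (as usual, this is meant for a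
representative of the class of functions that agree almost everywhere). -/
def ConvContinuousVanishing {X : Type*} [NormedAddCommGroup X] [NormedSpace ℝ X]
    (T : ℝ) (k : ℝ → ℝ) (u : ℝ → X) : Prop :=
  ∃ U : ℝ → X, ContinuousOn U (Icc 0 T) ∧ U 0 = 0 ∧
    ∀ᵐ t ∂(volume.restrict (Ioo 0 T)), U t = timeConv k u t

/-- The weak form of `∂ₜ(k ∗ [u - u₀]) - Δw ≤ f` with test functions in `V`. For every `n ≥ 1`,
with `h` the resolvent kernel associated with `n l` and `kₙ = k ∗ h`, and for every nonnegative
`ψ ∈ V`, one has, for almost all `t ∈ (0,T)`,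
`∫_Ω (ψ ∂ₜ(kₙ ∗ [u - u₀]) + (h ∗ ∇w) · ∇ψ) dx ≤ ∫_Ω (h ∗ f) ψ dx`.
Since `kₙ` is locally absolutely continuous, the derivative of the `L₂(Ω)`-valued function
`kₙ ∗ [u - u₀]` exists for almost all `t` when `u` is square integrable. -/
def IsWeakSubsolution {N : ℕ} {Ω : Set (EuclideanSpace ℝ (Fin N))} (T : ℝ) (k l : ℝ → ℝ)
    (V : Set (L2 Ω ℝ × L2 Ω (EuclideanSpace ℝ (Fin N))))
    (u₀ : L2 Ω ℝ) (f u : ℝ → L2 Ω ℝ)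
    (w : ℝ → L2 Ω ℝ × L2 Ω (EuclideanSpace ℝ (Fin N))) : Prop :=
  ∀ n : ℕ, 1 ≤ n → ∀ h : ℝ → ℝ, IsResolventKernel n l h →
    ∀ ψ ∈ V, (∀ᵐ x ∂(volume.restrict Ω), 0 ≤ ψ.1 x) →
      ∀ᵐ t ∂(volume.restrict (Ioo 0 T)),
        ∫ x in Ω, (ψ.1 x * deriv (timeConv (timeConv k h) (fun τ => u τ - u₀)) t x
            + inner ℝ (timeConv h (fun τ => (w τ).2) t x) (ψ.2 x))
          ≤ ∫ x in Ω, timeConv h f t x * ψ.1 x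

/-!
The inequality is obtained by using `w(t)` as a test function after the temporal regularisation has
been removed, and by bounding `∫₀ᵀ ⟪l ∗ ∇w, ∇w⟫ dt` from below.

*Removing the regularisation.* Write `h` for the resolvent kernel associated with `γ l`, so that
`δ - h` and `δ + γ l` are inverse to each other under convolution. From `k ∗ l = 1` one gets
`k ∗ h = γ (1 - 1 ∗ h)`, whence `∂ₜ((k ∗ h) ∗ v) = γ (v - h ∗ v)`
(`IsPCPair.deriv_timeConv_timeConv`). For fixed `ψ` put
`z = ⟪u - u₀ - l ∗ f, ψ⟫ + ⟪l ∗ ∇w, ∇ψ⟫`. The weak inequality with `γ = 1` says exactly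
`z - h ∗ z ≤ 0`, and since `h ≥ 0` a Gronwall argument (`nonpos_of_le_timeConv`) gives `z ≤ 0`; no
passage to the limit is needed. As `L₂(Ω)` is separable, the exceptional null sets can be chosen
independently of `ψ`, and `ψ = w(t)` becomes admissible (`IsWeakSubsolution.ae_le`). Integration
over `(0, T)` yields `∫ ⟪w, u⟫ + ∫ ⟪l ∗ ∇w, ∇w⟫ ≤ ∫ ⟪u₀ + l ∗ f, w⟫`.

*The energy inequality.* For `g` square integrable with values in a Hilbert space and
`v = l ∗ g + g / γ` one has `g = γ (v - h ∗ v)`. Bounding `⟪v(τ), v(t)⟫` by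
`(‖v(τ)‖² + ‖v(t)‖²) / 2` in `∫ ⟪h ∗ v, v⟫`, which is legitimate as `h ≥ 0`, gives
`∫ ⟪g, v⟫ ≥ ½ ∫ [κ(T - t) + κ(t)] ‖v(t)‖²` with `κ = γ (1 - 1 ∗ h)`
(`IsPCPair.integral_inner_yosida_ge`). As `γ → ∞`, `v → l ∗ g` and `κ → k` almost everywhere
(`IsPCPair.tendsto_yosidaKernel`; the kernels are nonincreasing, so convergence of their primitives
suffices), and Fatou's lemma gives the inequality for `k` and `l ∗ g`. Reversing time turns `l ∗ g`
into the dual convolution (`IsPCPair.integral_inner_ge_dualTimeConv`).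

*Facts about the resolvent kernel.* It exists as a Neumann series, which converges in `L₁(0, T)`
with an exponential weight (`exists_isResolventKernel`). Its nonnegativity
(`IsPCPair.resolvent_nonneg`)
follows from a maximum principle: with `K = k + γ` one has `K ∗ h = γ`, so that for smooth `G ≥ 0`
with `G(0) = 0` the Lipschitz function `y = h ∗ G` satisfies `K ∗ y = γ (1 ∗ G)`, which is
nondecreasing, and at a negative minimum of `y` the function `K ∗ y` would have to decrease
(`nonneg_of_monotoneOn_timeConv`). Hence `h ∗ G ≥ 0` for all such `G`, and `h ≥ 0` follows by
mollification.
-/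

open scoped Convolution Topology ENNReal


/-! ### Convolution on the half-line -/

section Basics

variable {F : Type*} [NormedAddCommGroup F] [NormedSpace ℝ F] {T : ℝ}

/-- On `[0, T]` the convolution depends only on the almost everywhere classes of the factors on
`(0, T)`. -/
theorem timeConv_congr {a a' : ℝ → ℝ} {g g' : ℝ → F} {t : ℝ} (ht : t ∈ Icc 0 T)
    (ha : ∀ᵐ s ∂(volume.restrict (Ioo 0 T)), a s = a' s)
    (hg : ∀ᵐ s ∂(volume.restrict (Ioo 0 T)), g s = g' s) :
    timeConv a g t = timeConv a' g' t := by
  rw [ae_restrict_iff' measurableSet_Ioo] at ha hg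
  have ha' := (quasiMeasurePreserving_sub_left_of_right_invariant (volume : Measure ℝ) t).ae ha
  have hne : ∀ᵐ s : ℝ, s ≠ t := by simp [ae_iff]
  refine intervalIntegral.integral_congr_ae ?_
  filter_upwards [ha', hg, hne] with s h1 h2 h3 hs
  rw [uIoc_of_le ht.1] at hs
  have hst : s < t := lt_of_le_of_ne hs.2 h3
  rw [h1 ⟨by linarith, by linarith [hs.1, ht.2]⟩, h2 ⟨hs.1, by linarith [ht.2]⟩]

/-- For causal functions, the convolution on the half-line is the convolution on `ℝ`. -/
theorem convolution_eq_timeConv {a : ℝ → ℝ} {g : ℝ → F} (ha : ∀ s ≤ 0, a s = 0)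
    (hg : ∀ s ≤ 0, g s = 0) {t : ℝ} (ht : 0 ≤ t) :
    (a ⋆[ContinuousLinearMap.lsmul ℝ ℝ, volume] g) t = timeConv a g t := by
  rw [convolution_lsmul_swap, timeConv, intervalIntegral.integral_of_le ht]
  symm
  apply setIntegral_eq_integral_of_forall_compl_eq_zero
  intro s hs
  simp only [mem_Ioc, not_and_or, not_lt, not_le] at hs
  rcases hs with hs | hs
  · rw [hg s hs, smul_zero]
  · rw [ha _ (by linarith), zero_smul]

theorem convolution_eq_zero_of_nonpos {a : ℝ → ℝ} {g : ℝ → F} (ha : ∀ s ≤ 0, a s = 0)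
    (hg : ∀ s ≤ 0, g s = 0) {t : ℝ} (ht : t ≤ 0) :
    (a ⋆[ContinuousLinearMap.lsmul ℝ ℝ, volume] g) t = 0 := by
  rw [convolution_lsmul_swap]
  refine integral_eq_zero_of_ae (Eventually.of_forall fun s => ?_)
  rcases le_total s 0 with hs | hs
  · simp [hg s hs]
  · simp [ha (t - s) (by linarith)]

theorem indicator_Ioo_eq_zero_of_nonpos {E : Type*} [Zero E] (g : ℝ → E) :
    ∀ s ≤ (0 : ℝ), (Ioo 0 T).indicator g s = 0 := fun _ hs =>
  indicator_of_notMem (fun h => absurd h.1 (not_lt.2 hs)) _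

theorem ae_eq_indicator_Ioo {E : Type*} [Zero E] (g : ℝ → E) :
    ∀ᵐ s ∂(volume.restrict (Ioo 0 T)), g s = (Ioo 0 T).indicator g s := by
  filter_upwards [ae_restrict_mem measurableSet_Ioo] with s hs
  rw [indicator_of_mem hs]

/-- On `[0, T]` the convolution on the half-line agrees with the convolution on `ℝ` of the factors
cut off outside `(0, T)`; all integrability properties are inherited from the latter. -/
theorem timeConv_eq_convolution (a : ℝ → ℝ) (g : ℝ → F) {t : ℝ} (ht : t ∈ Icc 0 T) :
    timeConv a g t = ((Ioo 0 T).indicator a ⋆[ContinuousLinearMap.lsmul ℝ ℝ, volume]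
      (Ioo 0 T).indicator g) t := by
  rw [convolution_eq_timeConv (indicator_Ioo_eq_zero_of_nonpos a)
    (indicator_Ioo_eq_zero_of_nonpos g) ht.1]
  exact timeConv_congr ht (ae_eq_indicator_Ioo a) (ae_eq_indicator_Ioo g)

theorem integrableOn_timeConv {a : ℝ → ℝ} {g : ℝ → F} (ha : IntegrableOn a (Ioo 0 T))
    (hg : IntegrableOn g (Ioo 0 T)) : IntegrableOn (timeConv a g) (Ioo 0 T) := by
  have h := ((ha.integrable_indicator measurableSet_Ioo).integrable_convolution
    (ContinuousLinearMap.lsmul ℝ ℝ) (hg.integrable_indicator measurableSet_Ioo)).integrableOn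
      (s := Ioo 0 T)
  refine h.congr_fun (fun t ht => ?_) measurableSet_Ioo
  exact (timeConv_eq_convolution a g (Ioo_subset_Icc_self ht)).symm

theorem ae_intervalIntegrable_timeConv {a : ℝ → ℝ} {g : ℝ → F} (ha : IntegrableOn a (Ioo 0 T))
    (hg : IntegrableOn g (Ioo 0 T)) : ∀ᵐ t ∂(volume.restrict (Ioo 0 T)),
      IntervalIntegrable (fun τ => a (t - τ) • g τ) volume 0 t := by
  have h := (ha.integrable_indicator measurableSet_Ioo).ae_convolution_exists
    (ContinuousLinearMap.lsmul ℝ ℝ) (hg.integrable_indicator measurableSet_Ioo)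
  filter_upwards [ae_restrict_of_ae h, ae_restrict_mem measurableSet_Ioo] with t h ht
  rw [intervalIntegrable_iff_integrableOn_Ioo_of_le ht.1.le]
  refine (h.integrable_swap.integrableOn (s := Ioo 0 t)).congr_fun (fun s hs => ?_)
    measurableSet_Ioo
  have h1 : t - s ∈ Ioo 0 T := ⟨by linarith [hs.2], by linarith [hs.1, ht.2]⟩
  have h2 : s ∈ Ioo 0 T := ⟨hs.1, hs.2.trans ht.2⟩
  simp [indicator_of_mem h1, indicator_of_mem h2]

/-- If one factor is bounded, the integral defining the convolution converges for every time. -/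
theorem intervalIntegrable_timeConv_of_bounded {a : ℝ → ℝ} {g : ℝ → F} {C : ℝ}
    (ha : IntegrableOn a (Ioo 0 T)) (hg : IntegrableOn g (Ioo 0 T))
    (hC : ∀ s ∈ Ioo 0 T, |a s| ≤ C) {t : ℝ} (ht : t ∈ Icc 0 T) :
    IntervalIntegrable (fun τ => a (t - τ) • g τ) volume 0 t := by
  rw [intervalIntegrable_iff_integrableOn_Ioo_of_le ht.1]
  have hsub : Ioo 0 t ⊆ Ioo 0 T := Ioo_subset_Ioo_right ht.2
  have hm := (ha.integrable_indicator measurableSet_Ioo).aestronglyMeasurable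
    |>.comp_quasiMeasurePreserving
    (quasiMeasurePreserving_sub_left_of_right_invariant (volume : Measure ℝ) t)
  have key : ∀ s ∈ Ioo 0 t, t - s ∈ Ioo 0 T := fun s hs =>
    ⟨by linarith [hs.2], by linarith [hs.1, ht.2]⟩
  refine ((hg.mono_set hsub).bdd_smul C (φ := fun s => (Ioo 0 T).indicator a (t - s))
    hm.restrict ?_).congr ?_
  · filter_upwards [ae_restrict_mem measurableSet_Ioo] with s hs
    rw [indicator_of_mem (key s hs)]
    exact hC _ (key s hs)
  · filter_upwards [ae_restrict_mem measurableSet_Ioo] with s hs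
    simp [indicator_of_mem (key s hs)]

theorem timeConv_comm (a b : ℝ → ℝ) (t : ℝ) : timeConv a b t = timeConv b a t := by
  have := intervalIntegral.integral_comp_sub_left (a := 0) (b := t)
    (fun s => b (t - s) • a s) t
  simp only [sub_sub_cancel, sub_self, sub_zero] at this
  rw [timeConv, timeConv, ← this]
  exact intervalIntegral.integral_congr fun _ _ => by simp [mul_comm]

end Basics

section Assoc

variable {F : Type*} [NormedAddCommGroup F] [NormedSpace ℝ F] [CompleteSpace F] {T : ℝ}

/-- Associativity at a time at which the triple convolution converges absolutely. -/
theorem timeConv_assoc_aux {a b : ℝ → ℝ} {g : ℝ → F} (ha : IntegrableOn a (Ioo 0 T))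
    (hb : IntegrableOn b (Ioo 0 T)) (hg : IntegrableOn g (Ioo 0 T)) {t : ℝ} (ht : t ∈ Icc 0 T)
    (hex : ConvolutionExistsAt (fun x => ‖(Ioo 0 T).indicator a x‖)
      ((fun x => ‖(Ioo 0 T).indicator b x‖) ⋆[ContinuousLinearMap.mul ℝ ℝ, volume]
        fun x => ‖(Ioo 0 T).indicator g x‖) t (ContinuousLinearMap.mul ℝ ℝ) volume) :
    timeConv (timeConv a b) g t = timeConv a (timeConv b g) t := by
  have hA := ha.integrable_indicator measurableSet_Ioo
  have hB := hb.integrable_indicator measurableSet_Ioo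
  have hG := hg.integrable_indicator measurableSet_Ioo
  have zA := indicator_Ioo_eq_zero_of_nonpos (T := T) a
  have zB := indicator_Ioo_eq_zero_of_nonpos (T := T) b
  have zG := indicator_Ioo_eq_zero_of_nonpos (T := T) g
  have e1 : ∀ᵐ s ∂(volume.restrict (Ioo 0 T)), timeConv a b s =
      ((Ioo 0 T).indicator a ⋆[ContinuousLinearMap.lsmul ℝ ℝ, volume]
        (Ioo 0 T).indicator b) s := by
    filter_upwards [ae_restrict_mem measurableSet_Ioo] with s hs
    exact timeConv_eq_convolution a b (Ioo_subset_Icc_self hs)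
  have e2 : ∀ᵐ s ∂(volume.restrict (Ioo 0 T)), timeConv b g s =
      ((Ioo 0 T).indicator b ⋆[ContinuousLinearMap.lsmul ℝ ℝ, volume]
        (Ioo 0 T).indicator g) s := by
    filter_upwards [ae_restrict_mem measurableSet_Ioo] with s hs
    exact timeConv_eq_convolution b g (Ioo_subset_Icc_self hs)
  rw [timeConv_congr ht e1 (ae_eq_indicator_Ioo g), timeConv_congr ht (ae_eq_indicator_Ioo a) e2,
    ← convolution_eq_timeConv (fun s hs => convolution_eq_zero_of_nonpos zA zB hs) zG ht.1,
    ← convolution_eq_timeConv zA (fun s hs => convolution_eq_zero_of_nonpos zB zG hs) ht.1]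
  refine convolution_assoc _ _ _ _ (fun x y z => smul_assoc x y z) hA.aestronglyMeasurable
    hB.aestronglyMeasurable hG.aestronglyMeasurable
    (hA.ae_convolution_exists _ hB) (hB.norm.ae_convolution_exists _ hG.norm) hex

theorem timeConv_assoc {a b : ℝ → ℝ} {g : ℝ → F} (ha : IntegrableOn a (Ioo 0 T))
    (hb : IntegrableOn b (Ioo 0 T)) (hg : IntegrableOn g (Ioo 0 T)) :
    ∀ᵐ t ∂(volume.restrict (Ioo 0 T)),
      timeConv (timeConv a b) g t = timeConv a (timeConv b g) t := by
  have hA := ha.integrable_indicator measurableSet_Ioo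
  have hB := hb.integrable_indicator measurableSet_Ioo
  have hG := hg.integrable_indicator measurableSet_Ioo
  filter_upwards [ae_restrict_mem measurableSet_Ioo, ae_restrict_of_ae
    (hA.norm.ae_convolution_exists (ContinuousLinearMap.mul ℝ ℝ)
      (hB.norm.integrable_convolution (ContinuousLinearMap.mul ℝ ℝ) hG.norm))] with t ht h
  exact timeConv_assoc_aux ha hb hg (Ioo_subset_Icc_self ht) h

/-- If the first factor is bounded, associativity holds for every time. -/
theorem timeConv_assoc_of_bounded {a b : ℝ → ℝ} {g : ℝ → F} {C : ℝ}
    (ha : IntegrableOn a (Ioo 0 T)) (hb : IntegrableOn b (Ioo 0 T))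
    (hg : IntegrableOn g (Ioo 0 T)) (hC : ∀ s ∈ Ioo 0 T, |a s| ≤ C) {t : ℝ} (ht : t ∈ Icc 0 T) :
    timeConv (timeConv a b) g t = timeConv a (timeConv b g) t := by
  have hA := ha.integrable_indicator measurableSet_Ioo
  have hB := hb.integrable_indicator measurableSet_Ioo
  have hG := hg.integrable_indicator measurableSet_Ioo
  refine timeConv_assoc_aux ha hb hg ht ?_
  have hQ := hB.norm.integrable_convolution (ContinuousLinearMap.mul ℝ ℝ) hG.norm
  refine (hQ.comp_sub_left t).bdd_mul (c := max C 0) hA.norm.aestronglyMeasurable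
    (Eventually.of_forall fun s => ?_)
  by_cases hs : s ∈ Ioo 0 T
  · simpa [indicator_of_mem hs] using Or.inl (hC s hs)
  · simp [indicator_of_notMem hs]

end Assoc

/-! ### Algebraic rules and positivity -/

section Tools

variable {F : Type*} [NormedAddCommGroup F] [NormedSpace ℝ F] {T : ℝ}

theorem intervalIntegral_eq_integral_Ioo (g : ℝ → F) {t : ℝ} (ht : 0 ≤ t) :
    ∫ s in (0 : ℝ)..t, g s = ∫ s in Ioo 0 t, g s := by
  rw [intervalIntegral.integral_of_le ht, integral_Ioc_eq_integral_Ioo]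

theorem MeasureTheory.LocallyIntegrableOn.integrableOn_Ioo {g : ℝ → ℝ}
    (hg : LocallyIntegrableOn g (Ici 0)) (T : ℝ) : IntegrableOn g (Ioo 0 T) :=
  (hg.integrableOn_compact_subset Icc_subset_Ici_self isCompact_Icc).mono_set Ioo_subset_Icc_self

theorem intervalIntegrable_of_integrableOn_Ioo {E : Type*} [NormedAddCommGroup E]
    {g : ℝ → E} (hg : IntegrableOn g (Ioo 0 T))
    {s t : ℝ} (hs : s ∈ Icc 0 T) (ht : t ∈ Icc 0 T) : IntervalIntegrable g volume s t := by
  have h0 : IntervalIntegrable g volume 0 T :=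
    (intervalIntegrable_iff_integrableOn_Ioo_of_le (hs.1.trans hs.2)).2 hg
  refine h0.mono_set ?_
  rw [uIcc_of_le (hs.1.trans hs.2)]
  exact uIcc_subset_Icc hs ht

theorem timeConv_one (g : ℝ → F) (t : ℝ) :
    timeConv (fun _ => 1) g t = ∫ s in (0 : ℝ)..t, g s := by
  simp [timeConv]

theorem integrableOn_Ioo_const {E : Type*} [NormedAddCommGroup E] (c : E) :
    IntegrableOn (fun _ : ℝ => c) (Ioo 0 T) :=
  integrableOn_const (by simp)

/-- `1 ∗ (a ∗ g) = (1 ∗ a) ∗ g` at every time. -/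
theorem intervalIntegral_timeConv [CompleteSpace F] {a : ℝ → ℝ} {g : ℝ → F}
    (ha : IntegrableOn a (Ioo 0 T)) (hg : IntegrableOn g (Ioo 0 T)) {t : ℝ} (ht : t ∈ Icc 0 T) :
    ∫ s in (0 : ℝ)..t, timeConv a g s = timeConv (fun s => ∫ r in (0 : ℝ)..s, a r) g t := by
  have h := timeConv_assoc_of_bounded (C := 1) (integrableOn_Ioo_const (1 : ℝ)) ha hg
    (by simp) ht
  simp only [timeConv_one] at h
  rw [← h]
  congr 1
  funext s
  exact timeConv_one a s

theorem norm_timeConv_le (a : ℝ → ℝ) (g : ℝ → F) {t : ℝ} (ht : 0 ≤ t) :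
    ‖timeConv a g t‖ ≤ timeConv (fun s => |a s|) (fun s => ‖g s‖) t := by
  refine (intervalIntegral.norm_integral_le_integral_norm ht).trans_eq ?_
  simp only [timeConv, norm_smul, Real.norm_eq_abs, smul_eq_mul]

theorem timeConv_smul_left (c : ℝ) (a : ℝ → ℝ) (g : ℝ → F) (t : ℝ) :
    timeConv (fun s => c * a s) g t = c • timeConv a g t := by
  simp only [timeConv, mul_smul, intervalIntegral.integral_smul]

theorem timeConv_smul_right (c : ℝ) (a : ℝ → ℝ) (g : ℝ → F) (t : ℝ) :
    timeConv a (fun s => c • g s) t = c • timeConv a g t := by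
  simp only [timeConv, smul_comm _ c, intervalIntegral.integral_smul]

theorem timeConv_sub_left {a b : ℝ → ℝ} {g : ℝ → F} (ha : IntegrableOn a (Ioo 0 T))
    (hb : IntegrableOn b (Ioo 0 T)) (hg : IntegrableOn g (Ioo 0 T)) :
    ∀ᵐ t ∂(volume.restrict (Ioo 0 T)),
      timeConv (fun s => a s - b s) g t = timeConv a g t - timeConv b g t := by
  filter_upwards [ae_intervalIntegrable_timeConv ha hg, ae_intervalIntegrable_timeConv hb hg]
    with t h1 h2
  simp only [timeConv, sub_smul, intervalIntegral.integral_sub h1 h2]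

theorem timeConv_sub_right {a : ℝ → ℝ} {g g' : ℝ → F} (ha : IntegrableOn a (Ioo 0 T))
    (hg : IntegrableOn g (Ioo 0 T)) (hg' : IntegrableOn g' (Ioo 0 T)) :
    ∀ᵐ t ∂(volume.restrict (Ioo 0 T)),
      timeConv a (fun s => g s - g' s) t = timeConv a g t - timeConv a g' t := by
  filter_upwards [ae_intervalIntegrable_timeConv ha hg, ae_intervalIntegrable_timeConv ha hg']
    with t h1 h2
  simp only [timeConv, smul_sub, intervalIntegral.integral_sub h1 h2]

theorem ContinuousLinearMap.timeConv_comp_comm {F' : Type*} [NormedAddCommGroup F']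
    [NormedSpace ℝ F'] [CompleteSpace F] [CompleteSpace F'] (L : F →L[ℝ] F') {a : ℝ → ℝ}
    {g : ℝ → F} (ha : IntegrableOn a (Ioo 0 T)) (hg : IntegrableOn g (Ioo 0 T)) :
    ∀ᵐ t ∂(volume.restrict (Ioo 0 T)),
      L (timeConv a g t) = timeConv a (fun s => L (g s)) t := by
  filter_upwards [ae_intervalIntegrable_timeConv ha hg] with t h
  rw [timeConv, ← L.intervalIntegral_comp_comm h]
  simp [timeConv]

theorem timeConv_nonneg {a g : ℝ → ℝ} (ha : ∀ᵐ s ∂(volume.restrict (Ioo 0 T)), 0 ≤ a s)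
    (hg : ∀ᵐ s ∂(volume.restrict (Ioo 0 T)), 0 ≤ g s) {t : ℝ} (ht : t ∈ Icc 0 T) :
    0 ≤ timeConv a g t := by
  have e1 : ∀ᵐ s ∂(volume.restrict (Ioo 0 T)), a s = |a s| := by
    filter_upwards [ha] with s hs using (abs_of_nonneg hs).symm
  have e2 : ∀ᵐ s ∂(volume.restrict (Ioo 0 T)), g s = |g s| := by
    filter_upwards [hg] with s hs using (abs_of_nonneg hs).symm
  rw [timeConv_congr ht e1 e2]
  exact intervalIntegral.integral_nonneg ht.1 fun s _ => smul_nonneg (abs_nonneg _) (abs_nonneg _)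

/-- Monotonicity in the second factor, for a nonnegative kernel. -/
theorem timeConv_mono_right {a g g' : ℝ → ℝ} (ha : IntegrableOn a (Ioo 0 T))
    (hg : IntegrableOn g (Ioo 0 T)) (hg' : IntegrableOn g' (Ioo 0 T))
    (ha0 : ∀ᵐ s ∂(volume.restrict (Ioo 0 T)), 0 ≤ a s)
    (h : ∀ᵐ s ∂(volume.restrict (Ioo 0 T)), g s ≤ g' s) :
    ∀ᵐ t ∂(volume.restrict (Ioo 0 T)), timeConv a g t ≤ timeConv a g' t := by
  filter_upwards [timeConv_sub_right ha hg' hg, ae_restrict_mem measurableSet_Ioo] with t h1 ht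
  rw [← sub_nonneg, ← h1]
  refine timeConv_nonneg ha0 ?_ (Ioo_subset_Icc_self ht)
  filter_upwards [h] with s hs using sub_nonneg.2 hs

end Tools

/-! ### Square integrable functions -/

section Young

variable {F : Type*} [NormedAddCommGroup F] [NormedSpace ℝ F] {T : ℝ}

theorem integrableOn_of_memLp_two {E : Type*} [NormedAddCommGroup E] {g : ℝ → E}
    (hg : MemLp g 2 (volume.restrict (Ioo 0 T))) :
    IntegrableOn g (Ioo 0 T) :=
  hg.integrable (by norm_num)

/-- The integral of `|a (t - τ)| (x - ‖g τ‖)²` over `(0, t)` is nonnegative; this contains both the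
Cauchy–Schwarz inequality and the inequality between arithmetic and geometric means that are needed
for convolutions. -/
theorem timeConv_quadratic_nonneg {E : Type*} [NormedAddCommGroup E] {a : ℝ → ℝ} {g : ℝ → E}
    (ha : IntegrableOn a (Ioo 0 T))
    (hg : MemLp g 2 (volume.restrict (Ioo 0 T))) :
    ∀ᵐ t ∂(volume.restrict (Ioo 0 T)), ∀ x : ℝ, 0 ≤ (∫ s in (0 : ℝ)..t, |a s|) * (x * x)
      + (-(2 * timeConv (fun s => |a s|) (fun s => ‖g s‖) t)) * x
      + timeConv (fun s => |a s|) (fun s => ‖g s‖ ^ 2) t := by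
  have ha' : IntegrableOn (fun s => |a s|) (Ioo 0 T) := ha.abs
  have h1 : IntegrableOn (fun s => ‖g s‖) (Ioo 0 T) := (integrableOn_of_memLp_two hg).norm
  have h2 : IntegrableOn (fun s => ‖g s‖ ^ 2) (Ioo 0 T) := hg.integrable_norm_pow (by norm_num)
  filter_upwards [ae_intervalIntegrable_timeConv ha' h1, ae_intervalIntegrable_timeConv ha' h2,
    ae_restrict_mem measurableSet_Ioo] with t i1 i2 ht x
  have i0 : IntervalIntegrable (fun τ => |a (t - τ)|) volume 0 t := by
    have := (intervalIntegrable_of_integrableOn_Ioo ha' (left_mem_Icc.2 (ht.1.trans ht.2).le)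
      (Ioo_subset_Icc_self ht)).comp_sub_left t
    simpa using this.symm
  have e0 : ∫ s in (0 : ℝ)..t, |a s| = ∫ τ in (0 : ℝ)..t, |a (t - τ)| := by
    rw [intervalIntegral.integral_comp_sub_left (fun s => |a s|) t]; simp
  have e : ∀ τ, |a (t - τ)| * (x - ‖g τ‖) ^ 2 = |a (t - τ)| * (x * x)
      + (-(2 * x)) * (|a (t - τ)| • ‖g τ‖) + |a (t - τ)| • ‖g τ‖ ^ 2 := fun τ => by
    simp only [smul_eq_mul]; ring
  have hpos : 0 ≤ ∫ τ in (0 : ℝ)..t, |a (t - τ)| * (x - ‖g τ‖) ^ 2 :=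
    intervalIntegral.integral_nonneg ht.1.le fun τ _ => by positivity
  simp only [e] at hpos
  rw [intervalIntegral.integral_add ((i0.mul_const _).add (i1.const_mul _)) i2,
    intervalIntegral.integral_add (i0.mul_const _) (i1.const_mul _),
    intervalIntegral.integral_mul_const, intervalIntegral.integral_const_mul] at hpos
  rw [e0]
  refine hpos.trans_eq ?_
  simp only [timeConv]
  ring

theorem norm_timeConv_sq_le {a : ℝ → ℝ} {g : ℝ → F} (ha : IntegrableOn a (Ioo 0 T))
    (hg : MemLp g 2 (volume.restrict (Ioo 0 T))) :
    ∀ᵐ t ∂(volume.restrict (Ioo 0 T)), ‖timeConv a g t‖ ^ 2 ≤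
      (∫ s in Ioo 0 T, |a s|) * timeConv (fun s => |a s|) (fun s => ‖g s‖ ^ 2) t := by
  filter_upwards [timeConv_quadratic_nonneg ha hg, ae_restrict_mem measurableSet_Ioo]
    with t hquad ht
  have hd := discrim_le_zero hquad
  rw [discrim] at hd
  have hA : ∫ s in (0 : ℝ)..t, |a s| ≤ ∫ s in Ioo 0 T, |a s| := by
    rw [intervalIntegral_eq_integral_Ioo _ ht.1.le]
    exact setIntegral_mono_set ha.abs (Eventually.of_forall fun s => abs_nonneg _)
      (Ioo_subset_Ioo_right ht.2.le).eventuallyLE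
  have hQ : 0 ≤ timeConv (fun s => |a s|) (fun s => ‖g s‖ ^ 2) t :=
    intervalIntegral.integral_nonneg ht.1.le fun s _ => smul_nonneg (abs_nonneg _) (by positivity)
  calc ‖timeConv a g t‖ ^ 2 ≤ timeConv (fun s => |a s|) (fun s => ‖g s‖) t ^ 2 := by
        gcongr; exact norm_timeConv_le a g ht.1.le
    _ ≤ (∫ s in (0 : ℝ)..t, |a s|) * timeConv (fun s => |a s|) (fun s => ‖g s‖ ^ 2) t := by
        nlinarith
    _ ≤ _ := by gcongr

/-- Young's inequality: convolution with an integrable kernel maps `L₂(0,T)` to itself. -/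
theorem memLp_timeConv {a : ℝ → ℝ} {g : ℝ → F} (ha : IntegrableOn a (Ioo 0 T))
    (hg : MemLp g 2 (volume.restrict (Ioo 0 T))) :
    MemLp (timeConv a g) 2 (volume.restrict (Ioo 0 T)) := by
  have hm := (integrableOn_timeConv ha (integrableOn_of_memLp_two hg)).aestronglyMeasurable
  rw [memLp_two_iff_integrable_sq_norm hm]
  have h2 : IntegrableOn (fun s => ‖g s‖ ^ 2) (Ioo 0 T) := hg.integrable_norm_pow (by norm_num)
  refine ((integrableOn_timeConv ha.abs h2).const_mul (∫ s in Ioo 0 T, |a s|)).mono'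
    (hm.norm.pow 2) ?_
  filter_upwards [norm_timeConv_sq_le ha hg] with t ht
  simpa using ht

end Young

/-! ### Exponential weights and a Gronwall lemma -/

section Weight

variable {T : ℝ}

/-- The exponential weight that makes convolution with `a` a contraction on `L₁(0, T)`. -/
theorem exists_exp_weight {a : ℝ → ℝ} (ha : IntegrableOn a (Ioo 0 T)) {ε : ℝ} (hε : 0 < ε) :
    ∃ r : ℝ, 0 ≤ r ∧ ∫ s in Ioo 0 T, Real.exp (-(r * s)) * |a s| < ε := by
  have h : Tendsto (fun r : ℝ => ∫ s in Ioo 0 T, Real.exp (-(r * s)) * |a s|) atTop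
      (𝓝 (∫ _ in Ioo 0 T, (0 : ℝ))) := by
    refine tendsto_integral_filter_of_dominated_convergence (fun s => |a s|)
      (Eventually.of_forall fun r => ?_) ?_ ha.abs ?_
    · exact (by fun_prop : Continuous fun s : ℝ =>
        Real.exp (-(r * s))).aestronglyMeasurable.mul ha.abs.aestronglyMeasurable
    · filter_upwards [eventually_ge_atTop 0] with r hr
      filter_upwards [ae_restrict_mem measurableSet_Ioo] with s hs
      rw [norm_mul, Real.norm_eq_abs, Real.norm_eq_abs, abs_abs, Real.abs_exp]
      refine mul_le_of_le_one_left (abs_nonneg _) (Real.exp_le_one_iff.2 ?_)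
      have := mul_nonneg hr hs.1.le
      linarith
    · filter_upwards [ae_restrict_mem measurableSet_Ioo] with s hs
      have : Tendsto (fun r : ℝ => Real.exp (-(r * s))) atTop (𝓝 0) :=
        Real.tendsto_exp_neg_atTop_nhds_zero.comp (tendsto_id.atTop_mul_const hs.1)
      simpa using this.mul_const |a s|
  simp only [integral_zero] at h
  obtain ⟨r, hr, hr0⟩ := ((h.eventually (gt_mem_nhds hε)).and (eventually_ge_atTop 0)).exists
  exact ⟨r, hr0, hr⟩

theorem integrableOn_exp_mul {a : ℝ → ℝ} (ha : IntegrableOn a (Ioo 0 T)) {r : ℝ} (hr : 0 ≤ r) :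
    IntegrableOn (fun s => Real.exp (-(r * s)) * a s) (Ioo 0 T) := by
  refine Integrable.bdd_mul (c := 1) ha
    (by fun_prop : Continuous fun s : ℝ => Real.exp (-(r * s))).aestronglyMeasurable ?_
  filter_upwards [ae_restrict_mem measurableSet_Ioo] with s hs
  rw [Real.norm_eq_abs, Real.abs_exp]
  refine Real.exp_le_one_iff.2 ?_
  have := mul_nonneg hr hs.1.le
  linarith

/-- Multiplication by an exponential is a homomorphism for the convolution. -/
theorem exp_mul_timeConv (r : ℝ) (a g : ℝ → ℝ) (t : ℝ) :
    Real.exp (-(r * t)) * timeConv a g t =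
      timeConv (fun s => Real.exp (-(r * s)) * a s) (fun s => Real.exp (-(r * s)) * g s) t := by
  rw [timeConv, timeConv, ← intervalIntegral.integral_const_mul]
  refine intervalIntegral.integral_congr fun s _ => ?_
  have : Real.exp (-(r * t)) = Real.exp (-(r * (t - s))) * Real.exp (-(r * s)) := by
    rw [← Real.exp_add]; ring_nf
  simp only [smul_eq_mul, this]
  ring

theorem integral_timeConv_le {a p : ℝ → ℝ} (ha : IntegrableOn a (Ioo 0 T))
    (hp : IntegrableOn p (Ioo 0 T)) (ha0 : ∀ s, 0 ≤ a s) (hp0 : ∀ s, 0 ≤ p s) :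
    ∫ t in Ioo 0 T, timeConv a p t ≤ (∫ s in Ioo 0 T, a s) * ∫ s in Ioo 0 T, p s := by
  have hA := ha.integrable_indicator measurableSet_Ioo
  have hP := hp.integrable_indicator measurableSet_Ioo
  have hA0 : ∀ s, 0 ≤ (Ioo 0 T).indicator a s := fun s => indicator_nonneg (fun _ _ => ha0 _) s
  have hP0 : ∀ s, 0 ≤ (Ioo 0 T).indicator p s := fun s => indicator_nonneg (fun _ _ => hp0 _) s
  calc ∫ t in Ioo 0 T, timeConv a p t
      = ∫ t in Ioo 0 T, ((Ioo 0 T).indicator a ⋆[ContinuousLinearMap.lsmul ℝ ℝ, volume]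
          (Ioo 0 T).indicator p) t :=
        setIntegral_congr_fun measurableSet_Ioo fun t ht =>
          timeConv_eq_convolution a p (Ioo_subset_Icc_self ht)
    _ ≤ ∫ t, ((Ioo 0 T).indicator a ⋆[ContinuousLinearMap.lsmul ℝ ℝ, volume]
          (Ioo 0 T).indicator p) t := by
        refine setIntegral_le_integral (hA.integrable_convolution _ hP)
          (Eventually.of_forall fun t => integral_nonneg fun s => ?_)
        exact mul_nonneg (hA0 _) (hP0 _)
    _ = (∫ s in Ioo 0 T, a s) * ∫ s in Ioo 0 T, p s := by
        rw [integral_convolution _ hA hP, integral_indicator measurableSet_Ioo,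
          integral_indicator measurableSet_Ioo]
        simp

theorem integral_exp_mul_timeConv_le {a p : ℝ → ℝ} (ha : IntegrableOn a (Ioo 0 T))
    (hp : IntegrableOn p (Ioo 0 T)) {r : ℝ} (hr : 0 ≤ r) :
    ∫ t in Ioo 0 T, Real.exp (-(r * t)) * |timeConv a p t| ≤
      (∫ s in Ioo 0 T, Real.exp (-(r * s)) * |a s|) *
        ∫ s in Ioo 0 T, Real.exp (-(r * s)) * |p s| := by
  refine le_trans ?_ (integral_timeConv_le (integrableOn_exp_mul ha.abs hr)
    (integrableOn_exp_mul hp.abs hr) (fun s => by positivity) (fun s => by positivity))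
  refine setIntegral_mono_on (integrableOn_exp_mul (integrableOn_timeConv ha hp).abs hr)
    (integrableOn_timeConv (integrableOn_exp_mul ha.abs hr) (integrableOn_exp_mul hp.abs hr))
    measurableSet_Ioo fun t ht => ?_
  rw [← exp_mul_timeConv]
  gcongr
  exact norm_timeConv_le a p ht.1.le

/-- A Gronwall lemma for Volterra inequalities: the positive part of `z` satisfies the same
inequality, and convolution with `h` is a strict contraction in a weighted `L₁` norm. -/
theorem nonpos_of_le_timeConv {h z : ℝ → ℝ} (hh : IntegrableOn h (Ioo 0 T))
    (hz : IntegrableOn z (Ioo 0 T)) (h0 : ∀ᵐ s ∂(volume.restrict (Ioo 0 T)), 0 ≤ h s)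
    (hle : ∀ᵐ t ∂(volume.restrict (Ioo 0 T)), z t ≤ timeConv h z t) :
    ∀ᵐ t ∂(volume.restrict (Ioo 0 T)), z t ≤ 0 := by
  obtain ⟨r, hr, hθ⟩ := exists_exp_weight hh one_pos
  set p : ℝ → ℝ := fun t => max (z t) 0 with hp
  have hpi : IntegrableOn p (Ioo 0 T) := hz.pos_part
  have hp0 : ∀ t, 0 ≤ p t := fun t => le_max_right _ _
  have hple : ∀ᵐ t ∂(volume.restrict (Ioo 0 T)), p t ≤ timeConv h p t := by
    filter_upwards [hle, timeConv_mono_right hh hz hpi h0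
      (Eventually.of_forall fun s => le_max_left _ _), ae_restrict_mem measurableSet_Ioo]
      with t h1 h2 ht
    exact max_le (h1.trans h2)
      (timeConv_nonneg h0 (Eventually.of_forall hp0) (Ioo_subset_Icc_self ht))
  have hI := integral_exp_mul_timeConv_le hh hpi hr
  have hmono : ∫ s in Ioo 0 T, Real.exp (-(r * s)) * |p s| ≤
      ∫ t in Ioo 0 T, Real.exp (-(r * t)) * |timeConv h p t| := by
    refine integral_mono_ae (integrableOn_exp_mul hpi.abs hr)
      (integrableOn_exp_mul (integrableOn_timeConv hh hpi).abs hr) ?_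
    filter_upwards [hple] with t ht
    have h1 : |p t| ≤ |timeConv h p t| := by
      rw [abs_of_nonneg (hp0 t)]; exact ht.trans (le_abs_self _)
    gcongr
  have hpos : 0 ≤ ∫ s in Ioo 0 T, Real.exp (-(r * s)) * |p s| :=
    integral_nonneg fun s => by positivity
  have hzero : ∫ s in Ioo 0 T, Real.exp (-(r * s)) * |p s| = 0 := by nlinarith
  rw [integral_eq_zero_iff_of_nonneg (fun s => by positivity)
    (integrableOn_exp_mul hpi.abs hr)] at hzero
  filter_upwards [hzero] with t ht
  have h1 : p t = 0 := by simpa [Real.exp_ne_zero] using ht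
  exact (le_max_left _ _).trans_eq h1

end Weight

/-! ### Existence of the resolvent kernel -/

section Resolvent

theorem ae_summable_and_integrable_tsum {α : Type*} [MeasurableSpace α] {μ : Measure α}
    {G : ℕ → α → ℝ} (hG : ∀ i, Integrable (G i) μ) (hs : Summable fun i => ∫ x, ‖G i x‖ ∂μ) :
    (∀ᵐ x ∂μ, Summable fun i => G i x) ∧ Integrable (fun x => ∑' i, G i x) μ := by
  have hfin : ∫⁻ x, ∑' i, ‖G i x‖ₑ ∂μ ≠ ⊤ := by
    rw [lintegral_tsum fun i => (hG i).aestronglyMeasurable.enorm]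
    have e : ∀ i, ∫⁻ x, ‖G i x‖ₑ ∂μ = ENNReal.ofReal (∫ x, ‖G i x‖ ∂μ) := fun i => by
      rw [ofReal_integral_norm_eq_lintegral_enorm (hG i)]
    simp only [e]
    rw [← ENNReal.ofReal_tsum_of_nonneg (fun i => integral_nonneg fun x => norm_nonneg _) hs]
    exact ENNReal.ofReal_ne_top
  have hsum : ∀ᵐ x ∂μ, Summable fun i => G i x := by
    filter_upwards [ae_lt_top' (AEMeasurable.tsum fun i =>
      (hG i).aestronglyMeasurable.enorm) hfin] with x hx
    exact (tsum_enorm_ne_top_iff_summable_norm.1 hx.ne).of_norm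
  refine ⟨hsum, ?_, ?_⟩
  · refine aestronglyMeasurable_of_tendsto_ae atTop
      (f := fun n x => ∑ i ∈ Finset.range n, G i x) (fun n => ?_) ?_
    · exact (Finset.range n).aestronglyMeasurable_fun_sum fun i _ => (hG i).aestronglyMeasurable
    · filter_upwards [hsum] with x hx using hx.hasSum.tendsto_sum_nat
  · refine lt_of_le_of_lt (lintegral_mono fun x => ?_) (lt_top_iff_ne_top.2 hfin)
    exact enorm_tsum_le_tsum_enorm

/-- The terms `L, -L ∗ L, L ∗ L ∗ L, …` of the Neumann series of the resolvent kernel. -/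
noncomputable def neumannTerm (L : ℝ → ℝ) : ℕ → ℝ → ℝ
  | 0 => L
  | j + 1 => fun t => -timeConv (neumannTerm L j) L t

variable {T : ℝ} {L : ℝ → ℝ}

theorem integrableOn_neumannTerm (hL : IntegrableOn L (Ioo 0 T)) (j : ℕ) :
    IntegrableOn (neumannTerm L j) (Ioo 0 T) := by
  induction j with
  | zero => exact hL
  | succ j ih => exact (integrableOn_timeConv ih hL).neg

theorem summable_integral_neumannTerm (hL : IntegrableOn L (Ioo 0 T)) :
    Summable fun j => ∫ s in Ioo 0 T, |neumannTerm L j s| := by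
  obtain ⟨r, hr, hθ⟩ := exists_exp_weight hL one_pos
  set θ := ∫ s in Ioo 0 T, Real.exp (-(r * s)) * |L s| with hθdef
  have hθ0 : 0 ≤ θ := integral_nonneg fun s => by positivity
  have hbound : ∀ j, ∫ s in Ioo 0 T, Real.exp (-(r * s)) * |neumannTerm L j s| ≤ θ ^ (j + 1) := by
    intro j
    induction j with
    | zero => simp [neumannTerm, hθdef]
    | succ j ih =>
      simp only [neumannTerm, abs_neg]
      refine (integral_exp_mul_timeConv_le (integrableOn_neumannTerm hL j) hL hr).trans ?_
      rw [pow_succ]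
      gcongr
  have hsum : Summable fun j : ℕ => Real.exp (r * T) * θ ^ (j + 1) :=
    ((summable_nat_add_iff 1).2 (summable_geometric_of_lt_one hθ0 hθ)).mul_left _
  refine Summable.of_nonneg_of_le (fun j => integral_nonneg fun s => abs_nonneg _)
    (fun j => ?_) hsum
  refine le_trans ?_ (mul_le_mul_of_nonneg_left (hbound j) (Real.exp_nonneg _))
  rw [← integral_const_mul]
  refine setIntegral_mono_on (integrableOn_neumannTerm hL j).abs
    ((integrableOn_exp_mul (integrableOn_neumannTerm hL j).abs hr).const_mul _) measurableSet_Ioo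
    fun s hs => ?_
  rw [← mul_assoc, ← Real.exp_add]
  refine le_mul_of_one_le_left (abs_nonneg _) (Real.one_le_exp ?_)
  nlinarith [hs.2]

theorem integrableOn_tsum_neumannTerm (hL : IntegrableOn L (Ioo 0 T)) :
    IntegrableOn (fun t => ∑' j, neumannTerm L j t) (Ioo 0 T) :=
  (ae_summable_and_integrable_tsum (integrableOn_neumannTerm hL)
    (summable_integral_neumannTerm hL)).2

/-- The sum `h` of the Neumann series solves `h + h ∗ L = L`. -/
theorem tsum_neumannTerm_add_timeConv (hL : IntegrableOn L (Ioo 0 T)) :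
    ∀ᵐ t ∂(volume.restrict (Ioo 0 T)),
      (∑' j, neumannTerm L j t) + timeConv (fun s => ∑' j, neumannTerm L j s) L t = L t := by
  have hc := integrableOn_neumannTerm hL
  have hs := summable_integral_neumannTerm hL
  have hd := ae_summable_and_integrable_tsum (μ := volume.restrict (Ioo 0 T))
    (G := fun j => timeConv (fun s => |neumannTerm L j s|) (fun s => |L s|))
    (fun j => integrableOn_timeConv (hc j).abs hL.abs) (by
      refine Summable.of_nonneg_of_le (fun j => integral_nonneg fun s => norm_nonneg _)
        (fun j => ?_) (hs.mul_right (∫ s in Ioo 0 T, |L s|))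
      refine le_trans (le_of_eq ?_) (integral_timeConv_le (hc j).abs hL.abs (fun _ => abs_nonneg _)
        (fun _ => abs_nonneg _))
      refine setIntegral_congr_fun measurableSet_Ioo fun t ht => ?_
      exact Real.norm_of_nonneg (intervalIntegral.integral_nonneg ht.1.le fun s _ =>
        mul_nonneg (abs_nonneg _) (abs_nonneg _)))
  filter_upwards [(ae_summable_and_integrable_tsum hc hs).1, hd.1,
    ae_all_iff.2 fun j => ae_intervalIntegrable_timeConv (hc j) hL,
    ae_restrict_mem measurableSet_Ioo] with t h1 h2 h3 ht
  simp only [smul_eq_mul] at h3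
  -- the series may be integrated term by term, since `∑ⱼ |cⱼ| ∗ |L|` converges almost everywhere
  have key : timeConv (fun s => ∑' j, neumannTerm L j s) L t =
      ∑' j, timeConv (neumannTerm L j) L t := by
    simp only [timeConv, intervalIntegral.integral_of_le ht.1.le, smul_eq_mul]
    rw [integral_tsum_of_summable_integral_norm (fun j => ((h3 j).1 :))]
    · simp only [tsum_mul_right]
    · refine h2.congr fun j => ?_
      simp only [timeConv, intervalIntegral.integral_of_le ht.1.le, smul_eq_mul, norm_mul,
        Real.norm_eq_abs]
  rw [key, h1.tsum_eq_zero_add]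
  simp only [neumannTerm, tsum_neg]
  ring

/-- Every locally integrable kernel has a resolvent kernel. -/
theorem exists_isResolventKernel {l : ℝ → ℝ} (hl : LocallyIntegrableOn l (Ici 0)) (γ : ℝ) :
    ∃ h, IsResolventKernel γ l h := by
  have hL : ∀ T, IntegrableOn (fun s => γ * l s) (Ioo 0 T) := fun T =>
    (hl.integrableOn_Ioo T).const_mul γ
  refine ⟨fun t => ∑' j, neumannTerm (fun s => γ * l s) j t, ?_, ?_⟩
  · intro x _
    refine ⟨Icc 0 (x + 1), ?_, ?_⟩
    · rw [← Ici_inter_Iic]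
      exact inter_mem self_mem_nhdsWithin (mem_nhdsWithin_of_mem_nhds (Iic_mem_nhds (by linarith)))
    · rw [integrableOn_Icc_iff_integrableOn_Ioo]
      exact integrableOn_tsum_neumannTerm (hL _)
  · have h : ∀ᵐ t : ℝ, ∀ n : ℕ, t ∈ Ioo (0 : ℝ) n →
        (∑' j, neumannTerm (fun s => γ * l s) j t) +
          timeConv (fun s => ∑' j, neumannTerm (fun s => γ * l s) j s) (fun s => γ * l s) t
            = γ * l t := ae_all_iff.2 fun n =>
      (ae_restrict_iff' measurableSet_Ioo).1 (tsum_neumannTerm_add_timeConv (hL n))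
    rw [ae_restrict_iff' measurableSet_Ioi]
    filter_upwards [h] with t ht h0
    obtain ⟨n, hn⟩ := exists_nat_gt t
    have := ht n ⟨h0, hn⟩
    rwa [show timeConv (fun s => ∑' j, neumannTerm (fun s => γ * l s) j s) (fun s => γ * l s) t =
      γ * timeConv (fun s => ∑' j, neumannTerm (fun s => γ * l s) j s) l t from
        timeConv_smul_right γ _ l t] at this

end Resolvent

/-! ### A maximum principle -/

section MaximumPrinciple

variable {T : ℝ}

/-- A maximum principle for `y ↦ ∂ₜ(K ∗ y)` with a nonincreasing kernel `K ≥ c > 0`. At a negative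
minimum `t₀` of `y` one compares `K ∗ y` at `t₀` and at `t₀ - ε`: the difference is at most
`ε (c y(t₀) + M ∫₀^ε K)`, which is negative for small `ε`. The Lipschitz continuity of `y`
compensates the possible singularity of `K` at `0`. -/
theorem nonneg_of_monotoneOn_timeConv {K y : ℝ → ℝ} {c M : ℝ}
    (hK : IntegrableOn K (Ioo 0 T)) (hanti : AntitoneOn K (Ioi 0)) (hc : 0 < c)
    (hKc : ∀ t, 0 < t → c ≤ K t)
    (hy : ∀ s ∈ Icc 0 T, ∀ t ∈ Icc 0 T, |y s - y t| ≤ M * |s - t|) (hy0 : y 0 = 0)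
    (hmono : MonotoneOn (timeConv K y) (Icc 0 T)) : ∀ t ∈ Icc 0 T, 0 ≤ y t := by
  intro t1 ht1
  have hT : 0 ≤ T := ht1.1.trans ht1.2
  have hcont : ContinuousOn y (Icc 0 T) := by
    have : LipschitzOnWith M.toNNReal y (Icc 0 T) := by
      refine LipschitzOnWith.of_dist_le_mul fun s hs t ht => ?_
      rw [Real.dist_eq, Real.dist_eq]
      exact (hy s hs t ht).trans (by gcongr; exact Real.le_coe_toNNReal M)
    exact this.continuousOn
  obtain ⟨t0, ht0, hmin⟩ := isCompact_Icc.exists_isMinOn ⟨t1, ht1⟩ hcont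
  have hmin' : ∀ s ∈ Icc 0 T, y t0 ≤ y s := fun s hs => hmin hs
  refine le_trans ?_ (hmin' t1 ht1)
  by_contra! hneg
  have ht0' : 0 < t0 := by
    rcases ht0.1.eq_or_lt with h | h
    · rw [← h, hy0] at hneg; exact absurd hneg (lt_irrefl _)
    · exact h
  have h0 : (0 : ℝ) ∈ Icc 0 T := left_mem_Icc.2 hT
  -- `∫₀^ε K` is small for small `ε`
  have hprim : Tendsto (fun ε => M * ∫ s in (0 : ℝ)..ε, K s) (𝓝[>] 0) (𝓝 0) := by
    have h1 : ContinuousOn (fun ε => ∫ s in (0 : ℝ)..ε, K s) (uIcc 0 T) :=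
      intervalIntegral.continuousOn_primitive_interval
        (by rwa [uIcc_of_le hT, integrableOn_Icc_iff_integrableOn_Ioo])
    have h2 := (h1 0 left_mem_uIcc).tendsto.const_mul M
    rw [uIcc_of_le hT] at h2
    simp only [intervalIntegral.integral_same, mul_zero] at h2
    refine h2.mono_left ?_
    rw [← nhdsWithin_Ioc_eq_nhdsGT (ht0'.trans_le ht0.2)]
    exact nhdsWithin_mono _ Ioc_subset_Icc_self
  have hev := (hprim.eventually (gt_mem_nhds (mul_pos (neg_pos.2 hneg) hc))).and
    (Ioo_mem_nhdsGT ht0')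
  obtain ⟨ε, hε, hε0, hεt⟩ := hev.exists
  have hd : 0 ≤ t0 - ε := by linarith
  have hdm : t0 - ε ∈ Icc 0 T := ⟨hd, by linarith [ht0.2]⟩
  have hεm : ε ∈ Icc 0 T := ⟨hε0.le, by linarith [ht0.2]⟩
  have hKi : ∀ s ∈ Icc 0 T, ∀ t ∈ Icc 0 T, IntervalIntegrable K volume s t := fun s hs t ht =>
    intervalIntegrable_of_integrableOn_Ioo hK hs ht
  have iK : IntervalIntegrable (fun τ => K (t0 - τ)) volume 0 t0 := by
    simpa using ((hKi 0 h0 t0 ht0).comp_sub_left t0).symm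
  have iK' : IntervalIntegrable (fun τ => K (t0 - ε - τ)) volume 0 (t0 - ε) := by
    simpa using ((hKi 0 h0 _ hdm).comp_sub_left (t0 - ε)).symm
  have iK1 : IntervalIntegrable (fun τ => K (t0 - τ)) volume 0 (t0 - ε) :=
    iK.mono_set (by
      rw [uIcc_of_le hd, uIcc_of_le ht0'.le]; exact Icc_subset_Icc_right (by linarith))
  have iK2 : IntervalIntegrable (fun τ => K (t0 - τ)) volume (t0 - ε) t0 :=
    iK.mono_set (by
      rw [uIcc_of_le (by linarith), uIcc_of_le ht0'.le]; exact Icc_subset_Icc_left hd)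
  have hyc : ∀ s ∈ Icc 0 T, ∀ t ∈ Icc 0 T, ContinuousOn y (uIcc s t) := fun s hs t ht =>
    hcont.mono (uIcc_subset_Icc hs ht)
  have e1 : timeConv K y t0 = (∫ τ in (0 : ℝ)..(t0 - ε), K (t0 - τ) * y τ)
      + ∫ τ in (t0 - ε)..t0, K (t0 - τ) * y τ :=
    (intervalIntegral.integral_add_adjacent_intervals
      (iK1.mul_continuousOn (hyc _ h0 _ hdm)) (iK2.mul_continuousOn (hyc _ hdm _ ht0))).symm
  have e2 : timeConv K y (t0 - ε) = ∫ τ in (0 : ℝ)..(t0 - ε), K (t0 - ε - τ) * y τ := rfl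
  -- on `(0, t₀ - ε)` the kernel increment is nonpositive, hence `y ≥ y(t₀)` gives an upper bound
  have b1 : (∫ τ in (0 : ℝ)..(t0 - ε), K (t0 - τ) * y τ)
      - (∫ τ in (0 : ℝ)..(t0 - ε), K (t0 - ε - τ) * y τ)
      ≤ ∫ τ in (0 : ℝ)..(t0 - ε), (K (t0 - τ) - K (t0 - ε - τ)) * y t0 := by
    rw [← intervalIntegral.integral_sub (iK1.mul_continuousOn (hyc _ h0 _ hdm))
      (iK'.mul_continuousOn (hyc _ h0 _ hdm))]
    refine intervalIntegral.integral_mono_on_of_le_Ioo hd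
      ((iK1.mul_continuousOn (hyc _ h0 _ hdm)).sub (iK'.mul_continuousOn (hyc _ h0 _ hdm)))
      ((iK1.sub iK').mul_const _) fun τ hτ => ?_
    have h1 : K (t0 - τ) ≤ K (t0 - ε - τ) := hanti (mem_Ioi.2 (by linarith [hτ.2]))
      (mem_Ioi.2 (by linarith [hτ.2])) (by linarith)
    have h2 := hmin' τ ⟨hτ.1.le, by linarith [hτ.2, hdm.2]⟩
    nlinarith
  -- on `(t₀ - ε, t₀)` the kernel is nonnegative and `y ≤ y(t₀) + M ε`
  have b2 : (∫ τ in (t0 - ε)..t0, K (t0 - τ) * y τ) ≤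
      ∫ τ in (t0 - ε)..t0, K (t0 - τ) * (y t0 + M * ε) := by
    refine intervalIntegral.integral_mono_on_of_le_Ioo (by linarith)
      (iK2.mul_continuousOn (hyc _ hdm _ ht0)) (iK2.mul_const _) fun τ hτ => ?_
    have hτm : τ ∈ Icc 0 T := ⟨by linarith [hτ.1], by linarith [hτ.2, ht0.2]⟩
    have h1 : 0 ≤ K (t0 - τ) := hc.le.trans (hKc _ (by linarith [hτ.2]))
    have h2 := (le_abs_self _).trans (hy τ hτm t0 ht0)
    have hM : 0 ≤ M := by
      have h3 := (abs_nonneg _).trans (hy 0 h0 t0 ht0)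
      rw [zero_sub, abs_neg, abs_of_pos ht0'] at h3
      exact nonneg_of_mul_nonneg_left h3 ht0'
    have h4 : M * |τ - t0| ≤ M * ε := by
      gcongr
      rw [abs_le]
      constructor <;> linarith [hτ.1, hτ.2]
    gcongr
    linarith
  have c1 : ∫ τ in (0 : ℝ)..(t0 - ε), (K (t0 - τ) - K (t0 - ε - τ)) * y t0 =
      ((∫ s in ε..t0, K s) - ∫ s in (0 : ℝ)..(t0 - ε), K s) * y t0 := by
    rw [intervalIntegral.integral_mul_const, intervalIntegral.integral_sub iK1 iK',
      intervalIntegral.integral_comp_sub_left K, intervalIntegral.integral_comp_sub_left K]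
    simp
  have c2 : ∫ τ in (t0 - ε)..t0, K (t0 - τ) * (y t0 + M * ε) =
      (∫ s in (0 : ℝ)..ε, K s) * (y t0 + M * ε) := by
    rw [intervalIntegral.integral_mul_const, intervalIntegral.integral_comp_sub_left K]
    simp
  have c3 : (∫ s in (0 : ℝ)..ε, K s) + ∫ s in ε..t0, K s =
      (∫ s in (0 : ℝ)..(t0 - ε), K s) + ∫ s in (t0 - ε)..t0, K s := by
    rw [intervalIntegral.integral_add_adjacent_intervals (hKi _ h0 _ hεm) (hKi _ hεm _ ht0),
      intervalIntegral.integral_add_adjacent_intervals (hKi _ h0 _ hdm) (hKi _ hdm _ ht0)]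
  have c4 : ε * c ≤ ∫ s in (t0 - ε)..t0, K s := by
    have := intervalIntegral.integral_mono_on_of_le_Ioo (f := fun _ => c) (by linarith)
      intervalIntegrable_const (hKi _ hdm _ ht0) fun s hs => hKc s (by linarith [hs.1])
    simpa using this
  have hle := hmono hdm ht0 (by linarith : t0 - ε ≤ t0)
  rw [e1, e2] at hle
  set A := ∫ s in (0 : ℝ)..ε, K s
  set B := ∫ s in (t0 - ε)..t0, K s
  have hfin : 0 ≤ B * y t0 + ε * (M * A) := by
    have h5 : (∫ s in ε..t0, K s) - ∫ s in (0 : ℝ)..(t0 - ε), K s = B - A := by linarith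
    rw [c1, h5] at b1
    rw [c2] at b2
    nlinarith
  nlinarith

end MaximumPrinciple

/-! ### Nonnegativity of the resolvent kernel -/

section Resolvent

variable {T γ : ℝ} {k l h : ℝ → ℝ}

theorem ae_restrict_Ioo_of_Ioi {p : ℝ → Prop} (hp : ∀ᵐ t ∂(volume.restrict (Ioi (0 : ℝ))), p t)
    (T : ℝ) : ∀ᵐ t ∂(volume.restrict (Ioo 0 T)), p t :=
  ae_restrict_of_ae_restrict_of_subset Ioo_subset_Ioi_self hp

/-- `k ∗ h + γ (1 ∗ h) = γ`, that is, `(k + γ) ∗ h = γ`: convolve the resolvent equation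
with `k`. -/
theorem IsPCPair.timeConv_add_integral_resolvent (hkl : IsPCPair k l)
    (hh : IsResolventKernel γ l h) (T : ℝ) : ∀ᵐ t ∂(volume.restrict (Ioo 0 T)),
      timeConv k h t + γ * ∫ s in (0 : ℝ)..t, h s = γ := by
  have ik := hkl.locallyIntegrable_k.integrableOn_Ioo T
  have il := hkl.locallyIntegrable_l.integrableOn_Ioo T
  have ih := hh.locallyIntegrable.integrableOn_Ioo T
  have heq : ∀ᵐ s ∂(volume.restrict (Ioo 0 T)), h s = γ * l s - γ * timeConv l h s := by
    filter_upwards [ae_restrict_Ioo_of_Ioi hh.equation T] with s hs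
    rw [timeConv_comm l h]; linarith
  filter_upwards [timeConv_sub_right ik (il.const_mul γ)
      ((integrableOn_timeConv il ih).const_mul γ),
    timeConv_assoc ik il ih, ae_restrict_Ioo_of_Ioi hkl.conv_eq_one T,
    ae_restrict_mem measurableSet_Ioo] with t h1 h2 h3 ht
  have ht' := Ioo_subset_Icc_self ht
  have e := timeConv_congr ht' (ae_of_all _ fun s => (rfl : k s = k s)) heq
  have e' := timeConv_congr ht' (ae_restrict_Ioo_of_Ioi hkl.conv_eq_one T)
    (ae_of_all _ fun s => (rfl : h s = h s))
  have s1 : timeConv k (fun s => γ * l s) t = γ * timeConv k l t := timeConv_smul_right γ k l t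
  have s2 : timeConv k (fun s => γ * timeConv l h s) t = γ * timeConv k (timeConv l h) t :=
    timeConv_smul_right γ k _ t
  rw [timeConv_one] at e'
  rw [e, h1, s1, s2, h3, ← h2, e']
  ring

/-- The maximum principle applied to `y = h ∗ G` and `K = k + γ`, for which `K ∗ y = γ (1 ∗ G)`. -/
theorem IsPCPair.timeConv_resolvent_nonneg_of_contDiff (hkl : IsPCPair k l)
    (hh : IsResolventKernel γ l h) (hγ : 0 < γ) {G : ℝ → ℝ} (hG : ContDiff ℝ 1 G) (hG0 : G 0 = 0)
    (hGn : ∀ t, 0 ≤ G t) : ∀ t ∈ Icc 0 T, 0 ≤ timeConv h G t := by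
  have ik := hkl.locallyIntegrable_k.integrableOn_Ioo T
  have ih := hh.locallyIntegrable.integrableOn_Ioo T
  have iK : IntegrableOn (fun t => k t + γ) (Ioo 0 T) := ik.add (integrableOn_Ioo_const γ)
  have hφc : Continuous (deriv G) := hG.continuous_deriv le_rfl
  have iφ : IntegrableOn (deriv G) (Ioo 0 T) :=
    hφc.integrableOn_Icc.mono_set Ioo_subset_Icc_self
  have hFTC : ∀ t, ∫ s in (0 : ℝ)..t, deriv G s = G t := fun t => by
    rw [intervalIntegral.integral_deriv_eq_sub' G rfl (fun x _ => hG.differentiable one_ne_zero x)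
      hφc.continuousOn, hG0, sub_zero]
  have iρ := integrableOn_timeConv iφ ih
  -- `y = h ∗ G` is the primitive of `G' ∗ h`
  have hy : ∀ t ∈ Icc 0 T, timeConv h G t = ∫ s in (0 : ℝ)..t, timeConv (deriv G) h s := by
    intro t ht
    rw [intervalIntegral_timeConv iφ ih ht, timeConv_comm]
    simp only [hFTC]
  obtain ⟨C, hC⟩ := isCompact_Icc.exists_bound_of_continuousOn (hφc.continuousOn (s := Icc 0 T))
  have hρ : ∀ t ∈ Icc 0 T, ‖timeConv (deriv G) h t‖ ≤ C * ∫ s in Ioo 0 T, |h s| := by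
    intro t ht
    have ih' := intervalIntegrable_of_integrableOn_Ioo ih.abs
      (left_mem_Icc.2 (ht.1.trans ht.2)) ht
    have hC0 : 0 ≤ C := (norm_nonneg _).trans (hC t ht)
    calc ‖timeConv (deriv G) h t‖ ≤ ∫ s in (0 : ℝ)..t, C * |h s| := by
          refine intervalIntegral.norm_integral_le_of_norm_le ht.1
            (Eventually.of_forall fun s hs => ?_) (ih'.const_mul C)
          rw [norm_smul]
          exact mul_le_mul_of_nonneg_right
            (hC _ ⟨by linarith [hs.2], by linarith [hs.1, ht.2]⟩) (abs_nonneg _)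
      _ = C * ∫ s in Ioo 0 t, |h s| := by
          rw [intervalIntegral.integral_const_mul, intervalIntegral_eq_integral_Ioo _ ht.1]
      _ ≤ _ := by
          gcongr
          · exact Eventually.of_forall fun s => abs_nonneg _
          · exact ih.abs
          · exact ht.2
  have hKh : ∀ᵐ t ∂(volume.restrict (Ioo 0 T)), timeConv (fun s => k s + γ) h t = γ := by
    filter_upwards [hkl.timeConv_add_integral_resolvent hh T,
      timeConv_sub_left iK (integrableOn_Ioo_const γ) ih] with t h1 h2
    have e : timeConv (fun _ => γ) h t = γ * ∫ s in (0 : ℝ)..t, h s := by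
      simp [timeConv]
    simp only [add_sub_cancel_right] at h2
    change timeConv k h t = _ at h2
    rw [e] at h2
    linarith
  have hKρ : ∀ᵐ t ∂(volume.restrict (Ioo 0 T)),
      timeConv (timeConv (deriv G) h) (fun s => k s + γ) t = γ * G t := by
    filter_upwards [timeConv_assoc iK ih iφ, ae_restrict_mem measurableSet_Ioo] with t h1 ht
    have e := timeConv_congr (Ioo_subset_Icc_self ht) hKh
      (ae_of_all _ fun s => (rfl : deriv G s = deriv G s))
    have e2 : timeConv (fun _ => γ) (deriv G) t = γ * ∫ s in (0 : ℝ)..t, deriv G s := by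
      simp [timeConv]
    rw [timeConv_comm, funext (timeConv_comm (deriv G) h), ← h1, e, e2, hFTC]
  have hconv : ∀ t ∈ Icc 0 T, timeConv (fun s => k s + γ) (timeConv h G) t =
      ∫ s in (0 : ℝ)..t, γ * G s := by
    intro t ht
    have e : ∀ᵐ s ∂(volume.restrict (Ioo 0 T)), timeConv h G s =
        ∫ r in (0 : ℝ)..s, timeConv (deriv G) h r := by
      filter_upwards [ae_restrict_mem measurableSet_Ioo] with s hs
      exact hy s (Ioo_subset_Icc_self hs)
    rw [timeConv_congr ht (ae_of_all _ fun s => (rfl : k s + γ = k s + γ)) e, timeConv_comm,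
      ← intervalIntegral_timeConv iρ iK ht, intervalIntegral_eq_integral_Ioo _ ht.1,
      intervalIntegral_eq_integral_Ioo _ ht.1]
    exact integral_congr_ae (ae_restrict_of_ae_restrict_of_subset (Ioo_subset_Ioo_right ht.2) hKρ)
  refine nonneg_of_monotoneOn_timeConv (K := fun s => k s + γ) (c := γ)
    (M := C * ∫ s in Ioo 0 T, |h s|) iK ?_ hγ ?_ ?_ ?_ ?_
  · intro s hs t ht hst
    exact add_le_add_left (hkl.antitone_k hs ht hst) γ
  · intro t ht
    linarith [hkl.nonneg_k t ht]
  · intro s hs t ht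
    have hT : 0 ≤ T := hs.1.trans hs.2
    rw [hy s hs, hy t ht, intervalIntegral.integral_interval_sub_left
      (intervalIntegrable_of_integrableOn_Ioo iρ (left_mem_Icc.2 hT) hs)
      (intervalIntegrable_of_integrableOn_Ioo iρ (left_mem_Icc.2 hT) ht)]
    exact intervalIntegral.norm_integral_le_of_norm_le_const fun r hr =>
      hρ r (uIcc_subset_Icc ht hs (uIoc_subset_uIcc hr))
  · simp [timeConv]
  · intro s hs t ht hst
    have hi : ∀ a b, IntervalIntegrable (fun r => γ * G r) volume a b := fun a b =>
      (continuous_const.mul hG.continuous).intervalIntegrable a b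
    rw [hconv s hs, hconv t ht, ← sub_nonneg, intervalIntegral.integral_interval_sub_left
      (hi _ _) (hi _ _)]
    exact intervalIntegral.integral_nonneg hst fun r _ => mul_nonneg hγ.le (hGn r)

/-- The resolvent kernels of `l` are nonnegative: the mollification of `h` at `x` is the value at
`T` of `h ∗ G` for the translated bump function `G(τ) = φ(τ - (T - x))`. -/
theorem IsPCPair.resolvent_nonneg (hkl : IsPCPair k l) (hh : IsResolventKernel γ l h)
    (hγ : 0 < γ) (T : ℝ) : ∀ᵐ t ∂(volume.restrict (Ioo 0 T)), 0 ≤ h t := by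
  have ih := hh.locallyIntegrable.integrableOn_Ioo T
  have ig := ih.integrable_indicator measurableSet_Ioo
  let φ : ℕ → ContDiffBump (0 : ℝ) := fun i =>
    ⟨1 / ((i : ℝ) + 1), 2 * (1 / ((i : ℝ) + 1)), by positivity, by
      have : 0 < 1 / ((i : ℝ) + 1) := by positivity
      linarith⟩
  have hφ : Tendsto (fun i => (φ i).rOut) atTop (𝓝 0) := by
    have h := (tendsto_one_div_add_atTop_nhds_zero_nat (𝕜 := ℝ)).const_mul 2
    rwa [mul_zero] at h
  have hlim := ContDiffBump.ae_convolution_tendsto_right_of_locallyIntegrable (μ := volume) hφ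
    (K := 2) (Eventually.of_forall fun i => le_rfl) ig.locallyIntegrable
  filter_upwards [ae_restrict_of_ae hlim, ae_restrict_mem measurableSet_Ioo] with x hx hxT
  rw [indicator_of_mem hxT] at hx
  refine ge_of_tendsto hx ?_
  filter_upwards [hφ.eventually (gt_mem_nhds (sub_pos.2 hxT.2))] with i hi
  have hT : 0 ≤ T := (hxT.1.trans hxT.2).le
  -- `G 0 = 0` since the support of the bump function has radius less than `T - x`
  have hn := hkl.timeConv_resolvent_nonneg_of_contDiff (T := T) hh hγ
    (G := fun τ => (φ i).normed volume (τ - (T - x)))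
    ((φ i).contDiff_normed.comp (contDiff_id.sub contDiff_const)) (by
      by_contra hne
      have := (φ i).support_normed_eq (μ := volume) ▸ Function.mem_support.2 hne
      rw [mem_ball_zero_iff, zero_sub, norm_neg, Real.norm_of_nonneg (by linarith [hxT.2])] at this
      linarith) (fun t => (φ i).nonneg_normed _) T (right_mem_Icc.2 hT)
  rw [timeConv_comm] at hn
  refine hn.trans_eq ?_
  rw [convolution_lsmul_swap, timeConv, intervalIntegral_eq_integral_Ioo _ hT,
    ← integral_indicator measurableSet_Ioo]
  refine integral_congr_ae (Eventually.of_forall fun s => ?_)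
  by_cases hs : s ∈ Ioo 0 T
  · simp only [indicator_of_mem hs]
    congr 2
    ring
  · simp [indicator_of_notMem hs]

end Resolvent

/-! ### Yosida approximation of the kernel -/

section Kernel

/-- For nonincreasing functions, convergence of the primitives implies convergence at every point of
continuity of the limit, since the value at `t` lies between the means over adjacent intervals. -/
theorem tendsto_of_antitoneOn_of_tendsto_integral {κ : ℕ → ℝ → ℝ} {k : ℝ → ℝ}
    (hκ : ∀ n, AntitoneOn (κ n) (Ioi 0)) (hk : AntitoneOn k (Ioi 0))
    (iκ : ∀ n t, 0 ≤ t → IntervalIntegrable (κ n) volume 0 t)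
    (ik : ∀ t, 0 ≤ t → IntervalIntegrable k volume 0 t)
    (hlim : ∀ t, 0 < t → Tendsto (fun n => ∫ s in (0 : ℝ)..t, κ n s) atTop
      (𝓝 (∫ s in (0 : ℝ)..t, k s)))
    {t : ℝ} (ht : 0 < t) (hc : ContinuousAt k t) : Tendsto (fun n => κ n t) atTop (𝓝 (k t)) := by
  have hlim' : ∀ a b, 0 < a → a < b → Tendsto (fun n => ∫ s in a..b, κ n s) atTop
      (𝓝 (∫ s in a..b, k s)) := by
    intro a b ha hab
    have h := (hlim b (ha.trans hab)).sub (hlim a ha)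
    rw [intervalIntegral.integral_interval_sub_left (ik b (ha.trans hab).le) (ik a ha.le)] at h
    refine h.congr fun n => ?_
    exact intervalIntegral.integral_interval_sub_left (iκ n b (ha.trans hab).le) (iκ n a ha.le)
  have up : ∀ (f : ℝ → ℝ), AntitoneOn f (Ioi 0) → (∀ t, 0 ≤ t → IntervalIntegrable f volume 0 t) →
      ∀ a b, 0 < a → a < b → (∫ s in a..b, f s) ≤ (b - a) * f a ∧
        (b - a) * f b ≤ ∫ s in a..b, f s := by
    intro f hf hi a b ha hab
    have hab' : IntervalIntegrable f volume a b :=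
      (hi a ha.le).symm.trans (hi b (ha.trans hab).le)
    constructor
    · have := intervalIntegral.integral_mono_on_of_le_Ioo hab.le hab'
        (intervalIntegrable_const (c := f a)) fun s hs => hf ha (ha.trans hs.1) hs.1.le
      simpa using this
    · have := intervalIntegral.integral_mono_on_of_le_Ioo hab.le
        (intervalIntegrable_const (c := f b)) hab' fun s hs =>
          hf (ha.trans hs.1) (ha.trans hab) hs.2.le
      simpa using this
  rw [tendsto_order]
  constructor
  · intro c hct
    obtain ⟨δ, hδ, hδc⟩ : ∃ δ > 0, c < k (t + δ) := by
      have h1 : Tendsto (fun δ => k (t + δ)) (𝓝[>] 0) (𝓝 (k t)) := by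
        have h2 : Tendsto (fun δ : ℝ => t + δ) (𝓝[>] 0) (𝓝 t) :=
          ((by fun_prop : Continuous fun δ : ℝ => t + δ).tendsto' 0 t (by simp)).mono_left
            nhdsWithin_le_nhds
        exact hc.tendsto.comp h2
      obtain ⟨δ, h3, h4⟩ := ((h1.eventually (lt_mem_nhds hct)).and self_mem_nhdsWithin).exists
      exact ⟨δ, h4, h3⟩
    have h1 := (up k hk ik t (t + δ) ht (by linarith)).2
    have h2 : δ * c < ∫ s in t..(t + δ), k s :=
      lt_of_lt_of_le (mul_lt_mul_of_pos_left hδc hδ) (by simpa using h1)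
    filter_upwards [(hlim' t (t + δ) ht (by linarith)).eventually (lt_mem_nhds h2)] with n hn
    have h3 := (up (κ n) (hκ n) (iκ n) t (t + δ) ht (by linarith)).1
    rw [add_sub_cancel_left] at h3
    exact lt_of_mul_lt_mul_left (hn.trans_le h3) hδ.le
  · intro c hct
    obtain ⟨δ, hδ, hδt, hδc⟩ : ∃ δ > 0, δ < t ∧ k (t - δ) < c := by
      have h1 : Tendsto (fun δ => k (t - δ)) (𝓝[>] 0) (𝓝 (k t)) := by
        have h2 : Tendsto (fun δ : ℝ => t - δ) (𝓝[>] 0) (𝓝 t) :=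
          ((by fun_prop : Continuous fun δ : ℝ => t - δ).tendsto' 0 t (by simp)).mono_left
            nhdsWithin_le_nhds
        exact hc.tendsto.comp h2
      obtain ⟨δ, h3, h4⟩ := ((h1.eventually (gt_mem_nhds hct)).and (Ioo_mem_nhdsGT ht)).exists
      exact ⟨δ, h4.1, h4.2, h3⟩
    have h1 := (up k hk ik (t - δ) t (by linarith) (by linarith)).1
    have h2 : ∫ s in (t - δ)..t, k s < δ * c :=
      lt_of_le_of_lt (by simpa using h1) (mul_lt_mul_of_pos_left hδc hδ)
    filter_upwards [(hlim' (t - δ) t (by linarith) (by linarith)).eventually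
      (gt_mem_nhds h2)] with n hn
    have h3 := (up (κ n) (hκ n) (iκ n) (t - δ) t (by linarith) (by linarith)).2
    rw [sub_sub_cancel] at h3
    exact lt_of_mul_lt_mul_left (h3.trans_lt hn) hδ.le

/-- The continuous representative `γ (1 - 1 ∗ h)` of the Yosida approximation `k ∗ h` of `k`, where
`h` is the resolvent kernel associated with `γ l`. -/
noncomputable def yosidaKernel (γ : ℝ) (h : ℝ → ℝ) (t : ℝ) : ℝ :=
  γ * (1 - ∫ s in (0 : ℝ)..t, h s)

variable {γ : ℝ} {k l h : ℝ → ℝ}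

theorem IsPCPair.timeConv_resolvent_eq (hkl : IsPCPair k l) (hh : IsResolventKernel γ l h)
    (T : ℝ) : ∀ᵐ t ∂(volume.restrict (Ioo 0 T)), timeConv k h t = yosidaKernel γ h t := by
  filter_upwards [hkl.timeConv_add_integral_resolvent hh T] with t ht
  rw [yosidaKernel]
  linarith

theorem IsResolventKernel.intervalIntegrable (hh : IsResolventKernel γ l h) {s t : ℝ}
    (hs : 0 ≤ s) (ht : 0 ≤ t) : IntervalIntegrable h volume s t :=
  intervalIntegrable_of_integrableOn_Ioo
    (hh.locallyIntegrable.integrableOn_Ioo (max s t))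
    ⟨hs, le_max_left _ _⟩ ⟨ht, le_max_right _ _⟩

theorem IsPCPair.integral_resolvent_mono (hkl : IsPCPair k l) (hh : IsResolventKernel γ l h)
    (hγ : 0 < γ) : MonotoneOn (fun t => ∫ s in (0 : ℝ)..t, h s) (Ici 0) := by
  intro s hs t ht hst
  rw [← sub_nonneg, intervalIntegral.integral_interval_sub_left
    (hh.intervalIntegrable le_rfl ht) (hh.intervalIntegrable le_rfl hs)]
  rw [intervalIntegral.integral_of_le hst, integral_Ioc_eq_integral_Ioo]
  exact setIntegral_nonneg_of_ae_restrict (ae_restrict_of_ae_restrict_of_subset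
    (Ioo_subset_Ioo_left hs) (hkl.resolvent_nonneg hh hγ t))

theorem IsPCPair.antitoneOn_yosidaKernel (hkl : IsPCPair k l) (hh : IsResolventKernel γ l h)
    (hγ : 0 < γ) : AntitoneOn (yosidaKernel γ h) (Ici 0) := fun s hs t ht hst => by
  have := hkl.integral_resolvent_mono hh hγ hs ht hst
  simp only at this
  simp only [yosidaKernel]
  gcongr

/-- `k ∗ h ≥ 0` holds almost everywhere; by monotonicity it holds everywhere. -/
theorem IsPCPair.yosidaKernel_nonneg (hkl : IsPCPair k l) (hh : IsResolventKernel γ l h)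
    (hγ : 0 < γ) {t : ℝ} (ht : 0 ≤ t) : 0 ≤ yosidaKernel γ h t := by
  have hae : ∀ᵐ s ∂(volume.restrict (Ioo t (t + 1))), 0 ≤ yosidaKernel γ h s := by
    have h1 : ∀ᵐ s ∂(volume.restrict (Ioo 0 (t + 1))), 0 ≤ yosidaKernel γ h s := by
      filter_upwards [hkl.timeConv_resolvent_eq hh (t + 1), ae_restrict_mem measurableSet_Ioo]
        with s hs hs'
      rw [← hs]
      refine timeConv_nonneg ?_ (hkl.resolvent_nonneg hh hγ (t + 1)) (Ioo_subset_Icc_self hs')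
      filter_upwards [ae_restrict_mem measurableSet_Ioo] with r hr using hkl.nonneg_k r hr.1
    exact ae_restrict_of_ae_restrict_of_subset (Ioo_subset_Ioo_left ht) h1
  have hne : (volume.restrict (Ioo t (t + 1))) ≠ 0 := by
    rw [Ne, Measure.restrict_eq_zero]; simp
  have := ae_neBot.2 hne
  obtain ⟨s, hs, hs'⟩ := (hae.and (ae_restrict_mem measurableSet_Ioo)).exists
  exact hs.trans (hkl.antitoneOn_yosidaKernel hh hγ ht (ht.trans hs'.1.le) hs'.1.le)

theorem IsPCPair.integral_resolvent_mem_Icc (hkl : IsPCPair k l) (hh : IsResolventKernel γ l h)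
    (hγ : 0 < γ) {t : ℝ} (ht : 0 ≤ t) : ∫ s in (0 : ℝ)..t, h s ∈ Icc (0 : ℝ) 1 := by
  constructor
  · simpa using hkl.integral_resolvent_mono hh hγ (mem_Ici.2 le_rfl) (mem_Ici.2 ht) ht
  · have := nonneg_of_mul_nonneg_right (hkl.yosidaKernel_nonneg hh hγ ht) hγ
    linarith

theorem IsResolventKernel.continuousOn_integral (hh : IsResolventKernel γ l h) (T : ℝ) :
    ContinuousOn (fun t => ∫ s in (0 : ℝ)..t, h s) (Icc 0 T) := by
  rcases le_or_gt 0 T with hT | hT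
  · rw [← uIcc_of_le hT]
    exact intervalIntegral.continuousOn_primitive_interval'
      (hh.intervalIntegrable le_rfl hT) left_mem_uIcc
  · rw [Icc_eq_empty (not_le.2 hT)]; exact continuousOn_empty _

theorem IsResolventKernel.continuousOn_yosidaKernel (hh : IsResolventKernel γ l h) (T : ℝ) :
    ContinuousOn (yosidaKernel γ h) (Icc 0 T) :=
  continuousOn_const.mul (continuousOn_const.sub (hh.continuousOn_integral T))

theorem IsResolventKernel.intervalIntegrable_yosidaKernel (hh : IsResolventKernel γ l h) {t : ℝ}
    (ht : 0 ≤ t) : IntervalIntegrable (yosidaKernel γ h) volume 0 t := by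
  apply ContinuousOn.intervalIntegrable
  rw [uIcc_of_le ht]
  exact hh.continuousOn_yosidaKernel t

/-- `1 ∗ (k ∗ h) = (1 ∗ h) ∗ k`. -/
theorem IsPCPair.integral_yosidaKernel (hkl : IsPCPair k l) (hh : IsResolventKernel γ l h)
    {t : ℝ} (ht : 0 ≤ t) : ∫ s in (0 : ℝ)..t, yosidaKernel γ h s =
      ∫ s in Ioo 0 t, (∫ r in (0 : ℝ)..(t - s), h r) * k s := by
  have ik := hkl.locallyIntegrable_k.integrableOn_Ioo t
  have ih := hh.locallyIntegrable.integrableOn_Ioo t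
  have h1 := intervalIntegral_timeConv ih ik (right_mem_Icc.2 ht)
  rw [timeConv, intervalIntegral_eq_integral_Ioo _ ht, intervalIntegral_eq_integral_Ioo _ ht] at h1
  simp only [smul_eq_mul] at h1
  rw [← h1, intervalIntegral_eq_integral_Ioo _ ht]
  refine integral_congr_ae ?_
  filter_upwards [hkl.timeConv_resolvent_eq hh t] with s hs
  rw [← hs, timeConv_comm]

theorem IsPCPair.intervalIntegrable_k (hkl : IsPCPair k l) {t : ℝ} (ht : 0 ≤ t) :
    IntervalIntegrable k volume 0 t :=
  intervalIntegrable_of_integrableOn_Ioo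
    (hkl.locallyIntegrable_k.integrableOn_Ioo t)
    (left_mem_Icc.2 ht) (right_mem_Icc.2 ht)

theorem IsResolventKernel.aestronglyMeasurable_integral_sub (hh : IsResolventKernel γ l h)
    {t : ℝ} : AEStronglyMeasurable (fun s => ∫ r in (0 : ℝ)..(t - s), h r)
      (volume.restrict (Ioo 0 t)) := by
  refine ContinuousOn.aestronglyMeasurable ?_ measurableSet_Ioo
  exact (hh.continuousOn_integral t).comp (by fun_prop) fun s hs =>
    ⟨by linarith [hs.2], by linarith [hs.1]⟩

theorem IsPCPair.integral_yosidaKernel_le (hkl : IsPCPair k l) (hh : IsResolventKernel γ l h)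
    (hγ : 0 < γ) {t : ℝ} (ht : 0 ≤ t) :
    ∫ s in (0 : ℝ)..t, yosidaKernel γ h s ≤ ∫ s in (0 : ℝ)..t, k s := by
  have ik := hkl.locallyIntegrable_k.integrableOn_Ioo t
  rw [hkl.integral_yosidaKernel hh ht, intervalIntegral_eq_integral_Ioo _ ht]
  have hH : ∀ s ∈ Ioo 0 t, ∫ r in (0 : ℝ)..(t - s), h r ∈ Icc (0 : ℝ) 1 := fun s hs =>
    hkl.integral_resolvent_mem_Icc hh hγ (by linarith [hs.2])
  refine setIntegral_mono_on (Integrable.bdd_mul (c := 1) ik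
    hh.aestronglyMeasurable_integral_sub ?_) ik measurableSet_Ioo fun s hs => ?_
  · filter_upwards [ae_restrict_mem measurableSet_Ioo] with s hs
    rw [Real.norm_of_nonneg (hH s hs).1]
    exact (hH s hs).2
  · exact mul_le_of_le_one_left (hkl.nonneg_k s hs.1) (hH s hs).2

/-- The quantitative form of `1 ∗ h → 1` as `γ → ∞`: since the Yosida kernel is nonincreasing, its
value at `t` is at most the mean of `k` over `(0, t)`. -/
theorem IsPCPair.one_sub_integral_resolvent_le (hkl : IsPCPair k l)
    (hh : IsResolventKernel γ l h) (hγ : 0 < γ) {t : ℝ} (ht : 0 < t) :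
    1 - ∫ s in (0 : ℝ)..t, h s ≤ (∫ s in (0 : ℝ)..t, k s) / t / γ := by
  have h1 : t * yosidaKernel γ h t ≤ ∫ s in (0 : ℝ)..t, yosidaKernel γ h s := by
    have := intervalIntegral.integral_mono_on_of_le_Ioo ht.le
      (intervalIntegrable_const (c := yosidaKernel γ h t))
      (hh.intervalIntegrable_yosidaKernel ht.le) fun s hs =>
        hkl.antitoneOn_yosidaKernel hh hγ (mem_Ici.2 hs.1.le) (mem_Ici.2 ht.le) hs.2.le
    simpa using this
  have h2 := h1.trans (hkl.integral_yosidaKernel_le hh hγ ht.le)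
  rw [yosidaKernel] at h2
  rw [le_div_iff₀ hγ, le_div_iff₀ ht]
  linarith

/-- The Yosida kernels converge to `k` almost everywhere: their primitives `(1 ∗ h) ∗ k` converge to
`1 ∗ k` by dominated convergence, and `k` has at most countably many discontinuities. -/
theorem IsPCPair.tendsto_yosidaKernel (hkl : IsPCPair k l) {h : ℕ → ℝ → ℝ}
    (hh : ∀ n : ℕ, IsResolventKernel ((n : ℝ) + 1) l (h n)) (T : ℝ) :
    ∀ᵐ t ∂(volume.restrict (Ioo 0 T)),
      Tendsto (fun n : ℕ => yosidaKernel ((n : ℝ) + 1) (h n) t) atTop (𝓝 (k t)) := by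
  have hγ : ∀ n : ℕ, 0 < (n : ℝ) + 1 := fun n => by positivity
  have hone : ∀ t, 0 < t → Tendsto (fun n : ℕ => ∫ s in (0 : ℝ)..t, h n s) atTop (𝓝 1) := by
    intro t ht
    have h0 : Tendsto (fun n : ℕ => 1 - (∫ s in (0 : ℝ)..t, k s) / t / ((n : ℝ) + 1)) atTop
        (𝓝 1) := by
      have := (tendsto_one_div_add_atTop_nhds_zero_nat (𝕜 := ℝ)).const_mul
        ((∫ s in (0 : ℝ)..t, k s) / t)
      have h1 := this.const_sub 1
      rw [mul_zero, sub_zero] at h1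
      refine h1.congr fun n => ?_
      ring
    refine tendsto_of_tendsto_of_tendsto_of_le_of_le h0 tendsto_const_nhds (fun n => ?_)
      fun n => (hkl.integral_resolvent_mem_Icc (hh n) (hγ n) ht.le).2
    have := hkl.one_sub_integral_resolvent_le (hh n) (hγ n) ht
    simp only
    linarith
  have hint : ∀ t, 0 < t → Tendsto
      (fun n : ℕ => ∫ s in (0 : ℝ)..t, yosidaKernel ((n : ℝ) + 1) (h n) s) atTop
      (𝓝 (∫ s in (0 : ℝ)..t, k s)) := by
    intro t ht
    have ik := hkl.locallyIntegrable_k.integrableOn_Ioo t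
    rw [intervalIntegral_eq_integral_Ioo _ ht.le]
    simp only [fun n : ℕ => hkl.integral_yosidaKernel (hh n) ht.le]
    refine tendsto_integral_of_dominated_convergence k (fun n => ?_) ik (fun n => ?_) ?_
    · exact (hh n).aestronglyMeasurable_integral_sub.mul ik.aestronglyMeasurable
    · filter_upwards [ae_restrict_mem measurableSet_Ioo] with s hs
      have h1 := hkl.integral_resolvent_mem_Icc (hh n) (hγ n) (by linarith [hs.2] : 0 ≤ t - s)
      have h2 := hkl.nonneg_k s hs.1
      rw [Real.norm_of_nonneg (mul_nonneg h1.1 h2)]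
      exact mul_le_of_le_one_left h2 h1.2
    · filter_upwards [ae_restrict_mem measurableSet_Ioo] with s hs
      simpa using (hone (t - s) (by linarith [hs.2])).mul_const (k s)
  have hcount := hkl.antitone_k.countable_not_continuousWithinAt
  filter_upwards [ae_restrict_of_ae (hcount.ae_notMem volume), ae_restrict_mem measurableSet_Ioo]
    with t hc ht
  refine tendsto_of_antitoneOn_of_tendsto_integral (fun n =>
    (hkl.antitoneOn_yosidaKernel (hh n) (hγ n)).mono Ioi_subset_Ici_self) hkl.antitone_k
    (fun n t ht => (hh n).intervalIntegrable_yosidaKernel ht)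
    (fun t ht => hkl.intervalIntegrable_k ht) hint ht.1 ?_
  by_contra hcont
  refine hc ⟨ht.1, fun h' => hcont ?_⟩
  exact h'.continuousAt (Ioi_mem_nhds ht.1)

end Kernel

/-! ### The energy inequality -/

section Energy

variable {X : Type*} [NormedAddCommGroup X] [InnerProductSpace ℝ X] {T : ℝ}

theorem integrableOn_inner {v w : ℝ → X} (hv : MemLp v 2 (volume.restrict (Ioo 0 T)))
    (hw : MemLp w 2 (volume.restrict (Ioo 0 T))) :
    IntegrableOn (fun t => inner ℝ (v t) (w t)) (Ioo 0 T) := by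
  refine ((hv.integrable_norm_pow (by norm_num)).add
    (hw.integrable_norm_pow (by norm_num))).mono' (hv.1.inner hw.1)
    (Eventually.of_forall fun t => ?_)
  refine (norm_inner_le_norm _ _).trans ?_
  simp only [Pi.add_apply]
  nlinarith [sq_nonneg (‖v t‖ - ‖w t‖), sq_nonneg (‖v t‖), sq_nonneg (‖w t‖)]

theorem integral_comp_sub_left_Ioo {E : Type*} [NormedAddCommGroup E] [NormedSpace ℝ E]
    (g : ℝ → E) : ∫ t in Ioo 0 T, g (T - t) = ∫ t in Ioo 0 T, g t := by
  rcases le_or_gt 0 T with hT | hT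
  · rw [← intervalIntegral_eq_integral_Ioo _ hT, ← intervalIntegral_eq_integral_Ioo _ hT,
      intervalIntegral.integral_comp_sub_left g]
    simp
  · rw [Ioo_eq_empty (not_lt.2 hT.le)]; simp

theorem measurePreserving_sub_left_Ioo :
    MeasurePreserving (fun t => T - t) (volume.restrict (Ioo 0 T)) (volume.restrict (Ioo 0 T)) := by
  have h := (Measure.measurePreserving_sub_left (volume : Measure ℝ) T).restrict_preimage
    (measurableSet_Ioo (a := 0) (b := T))
  simpa using h

/-- For a nonnegative kernel `h`, `⟪h ∗ v, v⟫` is bounded by means of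
`⟪v τ, v t⟫ ≤ (‖v τ‖² + ‖v t‖²) / 2`. -/
theorem integral_inner_timeConv_le (hT : 0 ≤ T) {h : ℝ → ℝ} {v : ℝ → X}
    (hh : IntegrableOn h (Ioo 0 T)) (h0 : ∀ᵐ s ∂(volume.restrict (Ioo 0 T)), 0 ≤ h s)
    (hv : MemLp v 2 (volume.restrict (Ioo 0 T))) :
    ∫ t in Ioo 0 T, inner ℝ (timeConv h v t) (v t) ≤
      1 / 2 * ∫ t in Ioo 0 T,
        ((∫ s in (0 : ℝ)..(T - t), h s) + ∫ s in (0 : ℝ)..t, h s) * ‖v t‖ ^ 2 := by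
  have iq : IntegrableOn (fun t => ‖v t‖ ^ 2) (Ioo 0 T) := hv.integrable_norm_pow (by norm_num)
  have ihq := integrableOn_timeConv hh iq
  have hHc : ContinuousOn (fun t => ∫ s in (0 : ℝ)..t, h s) (Icc 0 T) := by
    rw [← uIcc_of_le hT]
    exact intervalIntegral.continuousOn_primitive_interval
      (by rwa [uIcc_of_le hT, integrableOn_Icc_iff_integrableOn_Ioo])
  obtain ⟨C, hC⟩ := isCompact_Icc.exists_bound_of_continuousOn hHc
  have iH : IntegrableOn (fun t => (∫ s in (0 : ℝ)..t, h s) * ‖v t‖ ^ 2) (Ioo 0 T) := by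
    refine Integrable.bdd_mul (c := C) iq
      ((hHc.mono Ioo_subset_Icc_self).aestronglyMeasurable measurableSet_Ioo) ?_
    filter_upwards [ae_restrict_mem measurableSet_Ioo] with t ht using hC t (Ioo_subset_Icc_self ht)
  have iH' : IntegrableOn (fun t => (∫ s in (0 : ℝ)..(T - t), h s) * ‖v t‖ ^ 2) (Ioo 0 T) := by
    refine Integrable.bdd_mul (c := C) iq (ContinuousOn.aestronglyMeasurable
      (hHc.comp (by fun_prop) fun s hs => ⟨by linarith [hs.2], by linarith [hs.1]⟩)
        measurableSet_Ioo) ?_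
    filter_upwards [ae_restrict_mem measurableSet_Ioo] with t ht
    exact hC (T - t) ⟨by linarith [ht.2], by linarith [ht.1]⟩
  have hpt : ∀ᵐ t ∂(volume.restrict (Ioo 0 T)), inner ℝ (timeConv h v t) (v t) ≤
      1 / 2 * (timeConv h (fun s => ‖v s‖ ^ 2) t + (∫ s in (0 : ℝ)..t, h s) * ‖v t‖ ^ 2) := by
    have habs : ∀ᵐ s ∂(volume.restrict (Ioo 0 T)), |h s| = h s := by
      filter_upwards [h0] with s hs using abs_of_nonneg hs
    filter_upwards [timeConv_quadratic_nonneg hh hv, ae_restrict_mem measurableSet_Ioo]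
      with t hquad ht
    have ht' := Ioo_subset_Icc_self ht
    have h1 := hquad ‖v t‖
    have e1 : ∫ s in (0 : ℝ)..t, |h s| = ∫ s in (0 : ℝ)..t, h s := by
      rw [intervalIntegral_eq_integral_Ioo _ ht.1.le, intervalIntegral_eq_integral_Ioo _ ht.1.le]
      exact integral_congr_ae
        (ae_restrict_of_ae_restrict_of_subset (Ioo_subset_Ioo_right ht.2.le) habs)
    rw [e1, timeConv_congr ht' habs (ae_of_all _ fun s => (rfl : ‖v s‖ ^ 2 = ‖v s‖ ^ 2))] at h1
    have h2 : inner ℝ (timeConv h v t) (v t) ≤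
        timeConv (fun s => |h s|) (fun s => ‖v s‖) t * ‖v t‖ :=
      (real_inner_le_norm _ _).trans (by gcongr; exact norm_timeConv_le h v ht.1.le)
    nlinarith
  have hfub : ∫ t in Ioo 0 T, timeConv h (fun s => ‖v s‖ ^ 2) t =
      ∫ t in Ioo 0 T, (∫ s in (0 : ℝ)..(T - t), h s) * ‖v t‖ ^ 2 := by
    have := intervalIntegral_timeConv hh iq (right_mem_Icc.2 hT)
    rwa [timeConv, intervalIntegral_eq_integral_Ioo _ hT,
      intervalIntegral_eq_integral_Ioo _ hT] at this
  refine (integral_mono_ae (integrableOn_inner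
    (memLp_timeConv hh hv) hv) ((ihq.add iH).const_mul _) hpt).trans_eq ?_
  simp only [add_mul]
  rw [integral_const_mul, integral_add' ihq iH, hfub, integral_add iH' iH]

/-- Fatou's lemma for nonnegative real functions whose integrals are bounded by a convergent
sequence. -/
theorem integrable_and_integral_le_of_tendsto {α : Type*} [MeasurableSpace α] {μ : Measure α}
    {p : ℕ → α → ℝ} {q : α → ℝ} {c : ℕ → ℝ} {d : ℝ} (hp : ∀ n, Integrable (p n) μ)
    (hp0 : ∀ n, ∀ᵐ x ∂μ, 0 ≤ p n x) (hlim : ∀ᵐ x ∂μ, Tendsto (fun n => p n x) atTop (𝓝 (q x)))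
    (hc : ∀ n, ∫ x, p n x ∂μ ≤ c n) (hcd : Tendsto c atTop (𝓝 d)) :
    Integrable q μ ∧ ∫ x, q x ∂μ ≤ d := by
  have hm : AEStronglyMeasurable q μ :=
    aestronglyMeasurable_of_tendsto_ae atTop (fun n => (hp n).aestronglyMeasurable) hlim
  have hq0 : 0 ≤ᵐ[μ] q := by
    filter_upwards [hlim, ae_all_iff.2 hp0] with x h1 h2
    exact ge_of_tendsto' h1 h2
  have hle : ∫⁻ x, ENNReal.ofReal (q x) ∂μ ≤ ENNReal.ofReal d := by
    calc ∫⁻ x, ENNReal.ofReal (q x) ∂μ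
        = ∫⁻ x, liminf (fun n => ENNReal.ofReal (p n x)) atTop ∂μ := by
          refine lintegral_congr_ae ?_
          filter_upwards [hlim] with x hx
          exact ((ENNReal.continuous_ofReal.tendsto _).comp hx).liminf_eq.symm
      _ ≤ liminf (fun n => ∫⁻ x, ENNReal.ofReal (p n x) ∂μ) atTop :=
          lintegral_liminf_le' fun n => (hp n).aestronglyMeasurable.aemeasurable.ennreal_ofReal
      _ ≤ liminf (fun n => ENNReal.ofReal (c n)) atTop := by
          refine liminf_le_liminf (Eventually.of_forall fun n => ?_)
          rw [← ofReal_integral_eq_lintegral_ofReal (hp n) (hp0 n)]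
          exact ENNReal.ofReal_le_ofReal (hc n)
      _ = ENNReal.ofReal d := ((ENNReal.continuous_ofReal.tendsto _).comp hcd).liminf_eq
  have hd : 0 ≤ d := ge_of_tendsto' hcd fun n => (integral_nonneg_of_ae (hp0 n)).trans (hc n)
  have hi : Integrable q μ := by
    refine ⟨hm, ?_⟩
    rw [hasFiniteIntegral_iff_ofReal hq0]
    exact hle.trans_lt ENNReal.ofReal_lt_top
  refine ⟨hi, ?_⟩
  rw [← ofReal_integral_eq_lintegral_ofReal hi hq0] at hle
  exact (ENNReal.ofReal_le_ofReal_iff hd).1 hle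

variable [CompleteSpace X] {k l : ℝ → ℝ}

/-- The energy inequality for the Yosida approximation of `k`; the function `v = l ∗ g + g / γ`
solves `γ (v - h ∗ v) = g`, that is, `∂ₜ((k ∗ h) ∗ v) = g`. -/
theorem IsPCPair.integral_inner_yosida_ge (hkl : IsPCPair k l) {γ : ℝ} (hγ : 0 < γ) {h : ℝ → ℝ}
    (hh : IsResolventKernel γ l h) (hT : 0 ≤ T) {g : ℝ → X}
    (hg : MemLp g 2 (volume.restrict (Ioo 0 T))) :
    IntegrableOn (fun t => (yosidaKernel γ h (T - t) + yosidaKernel γ h t) *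
        ‖timeConv l g t + γ⁻¹ • g t‖ ^ 2) (Ioo 0 T) ∧
      ∫ t in Ioo 0 T, (yosidaKernel γ h (T - t) + yosidaKernel γ h t) *
        ‖timeConv l g t + γ⁻¹ • g t‖ ^ 2 ≤
      2 * ∫ t in Ioo 0 T, inner ℝ (g t) (timeConv l g t + γ⁻¹ • g t) := by
  have il := hkl.locallyIntegrable_l.integrableOn_Ioo T
  have ih := hh.locallyIntegrable.integrableOn_Ioo T
  have ig := integrableOn_of_memLp_two hg
  set v : ℝ → X := fun t => timeConv l g t + γ⁻¹ • g t with hvdef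
  have hv : MemLp v 2 (volume.restrict (Ioo 0 T)) :=
    (memLp_timeConv il hg).add (hg.const_smul γ⁻¹)
  have iq : IntegrableOn (fun t => ‖v t‖ ^ 2) (Ioo 0 T) := hv.integrable_norm_pow (by norm_num)
  have hhv := memLp_timeConv ih hv
  have hid : ∀ᵐ t ∂(volume.restrict (Ioo 0 T)), g t = γ • (v t - timeConv h v t) := by
    have heq : ∀ᵐ s ∂(volume.restrict (Ioo 0 T)), γ * l s - h s = γ * timeConv h l s := by
      filter_upwards [ae_restrict_Ioo_of_Ioi hh.equation T] with s hs
      linarith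
    -- `δ - h` inverts `δ + γ l`, and `γ v = (δ + γ l) ∗ g`
    filter_upwards [timeConv_assoc ih il ig, timeConv_sub_left (il.const_mul γ) ih ig,
      timeConv_sub_right (g' := fun s => (-γ⁻¹) • g s) ih (integrableOn_timeConv il ig)
        (ig.smul (-γ⁻¹)), ae_restrict_mem measurableSet_Ioo] with t h1 h2 h3 ht
    have e1 := timeConv_congr (Ioo_subset_Icc_self ht) heq
      (ae_of_all _ fun s => (rfl : g s = g s))
    rw [h2, timeConv_smul_left, timeConv_smul_left, h1] at e1
    have hv' : v = fun s => timeConv l g s - (-γ⁻¹) • g s := by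
      funext s; simp [hvdef]
    have e2 : timeConv h v t = timeConv h (timeConv l g) t + γ⁻¹ • timeConv h g t := by
      rw [hv', h3, timeConv_smul_right, neg_smul, sub_neg_eq_add]
    rw [e2, hvdef]
    simp only [smul_sub, smul_add, smul_inv_smul₀ hγ.ne']
    rw [← e1]
    abel
  have hHc := hh.continuousOn_yosidaKernel T
  obtain ⟨C, hC⟩ := isCompact_Icc.exists_bound_of_continuousOn hHc
  have hint : IntegrableOn (fun t => (yosidaKernel γ h (T - t) + yosidaKernel γ h t) * ‖v t‖ ^ 2)
      (Ioo 0 T) := by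
    have hmem : ∀ t ∈ Ioo 0 T, T - t ∈ Icc 0 T := fun t ht =>
      ⟨by linarith [ht.2], by linarith [ht.1]⟩
    refine Integrable.bdd_mul (c := C + C) iq (ContinuousOn.aestronglyMeasurable
      ((hHc.comp (by fun_prop) hmem).add (hHc.mono Ioo_subset_Icc_self)) measurableSet_Ioo) ?_
    filter_upwards [ae_restrict_mem measurableSet_Ioo] with t ht
    exact (norm_add_le _ _).trans (add_le_add (hC _ (hmem t ht)) (hC t (Ioo_subset_Icc_self ht)))
  refine ⟨hint, ?_⟩
  have e1 : ∫ t in Ioo 0 T, inner ℝ (g t) (v t) =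
      γ * ((∫ t in Ioo 0 T, ‖v t‖ ^ 2) - ∫ t in Ioo 0 T, inner ℝ (timeConv h v t) (v t)) := by
    rw [← integral_sub iq (integrableOn_inner hhv hv), ← integral_const_mul]
    refine integral_congr_ae ?_
    filter_upwards [hid] with t ht
    rw [ht, real_inner_smul_left, inner_sub_left, real_inner_self_eq_norm_sq]
  have e2 : ∫ t in Ioo 0 T, (yosidaKernel γ h (T - t) + yosidaKernel γ h t) * ‖v t‖ ^ 2 =
      γ * (2 * (∫ t in Ioo 0 T, ‖v t‖ ^ 2) - ∫ t in Ioo 0 T,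
        ((∫ s in (0 : ℝ)..(T - t), h s) + ∫ s in (0 : ℝ)..t, h s) * ‖v t‖ ^ 2) := by
    have e3 : ∀ t, ((∫ s in (0 : ℝ)..(T - t), h s) + ∫ s in (0 : ℝ)..t, h s) * ‖v t‖ ^ 2 =
        2 * ‖v t‖ ^ 2 -
          γ⁻¹ * ((yosidaKernel γ h (T - t) + yosidaKernel γ h t) * ‖v t‖ ^ 2) := fun t => by
      simp only [yosidaKernel]
      field_simp
      ring
    simp only [e3]
    rw [integral_sub (iq.const_mul 2) (hint.const_mul _), integral_const_mul, integral_const_mul]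
    field_simp
    ring
  have h1 := integral_inner_timeConv_le hT ih (hkl.resolvent_nonneg hh hγ T) hv
  rw [e1, e2]
  nlinarith

/-- The energy inequality for `k`, obtained from its Yosida approximations by Fatou's lemma. -/
theorem IsPCPair.integral_inner_timeConv_ge (hkl : IsPCPair k l) (hT : 0 ≤ T) {g : ℝ → X}
    (hg : MemLp g 2 (volume.restrict (Ioo 0 T))) :
    IntegrableOn (fun t => (k (T - t) + k t) * ‖timeConv l g t‖ ^ 2) (Ioo 0 T) ∧
      ∫ t in Ioo 0 T, (k (T - t) + k t) * ‖timeConv l g t‖ ^ 2 ≤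
      2 * ∫ t in Ioo 0 T, inner ℝ (g t) (timeConv l g t) := by
  have il := hkl.locallyIntegrable_l.integrableOn_Ioo T
  choose h hh using fun n : ℕ => exists_isResolventKernel hkl.locallyIntegrable_l ((n : ℝ) + 1)
  have hγ : ∀ n : ℕ, 0 < (n : ℝ) + 1 := fun n => by positivity
  have hκ := hkl.tendsto_yosidaKernel hh T
  have hκ' := measurePreserving_sub_left_Ioo.quasiMeasurePreserving.ae hκ
  have hinv : Tendsto (fun n : ℕ => ((n : ℝ) + 1)⁻¹) atTop (𝓝 0) := by
    simpa using tendsto_one_div_add_atTop_nhds_zero_nat (𝕜 := ℝ)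
  refine integrable_and_integral_le_of_tendsto
    (fun n => (hkl.integral_inner_yosida_ge (hγ n) (hh n) hT hg).1) (fun n => ?_) ?_
    (fun n => (hkl.integral_inner_yosida_ge (hγ n) (hh n) hT hg).2) ?_
  · filter_upwards [ae_restrict_mem measurableSet_Ioo] with t ht
    exact mul_nonneg (add_nonneg
      (hkl.yosidaKernel_nonneg (hh n) (hγ n) (by linarith [ht.2]))
      (hkl.yosidaKernel_nonneg (hh n) (hγ n) ht.1.le)) (by positivity)
  · filter_upwards [hκ, hκ'] with t h1 h2
    have h3 : Tendsto (fun n : ℕ => timeConv l g t + ((n : ℝ) + 1)⁻¹ • g t) atTop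
        (𝓝 (timeConv l g t)) := by
      simpa using (hinv.smul_const (g t)).const_add (timeConv l g t)
    exact (h2.add h1).mul (h3.norm.pow 2)
  · have e : ∀ n : ℕ, ∫ t in Ioo 0 T, inner ℝ (g t) (timeConv l g t + ((n : ℝ) + 1)⁻¹ • g t) =
        (∫ t in Ioo 0 T, inner ℝ (g t) (timeConv l g t)) +
          ((n : ℝ) + 1)⁻¹ * ∫ t in Ioo 0 T, inner ℝ (g t) (g t) := fun n => by
      simp only [inner_add_right, real_inner_smul_right]
      rw [integral_add (integrableOn_inner hg (memLp_timeConv il hg))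
        ((integrableOn_inner hg hg).const_mul _), integral_const_mul]
    simp only [e]
    simpa using ((hinv.mul_const _).const_add _).const_mul 2

end Energy

/-! ### The dual convolution -/

section Dual

/-- The dual convolution is the convolution conjugated by time reversal. -/
theorem dualTimeConv_eq_timeConv {F : Type*} [NormedAddCommGroup F] [NormedSpace ℝ F] (T : ℝ)
    (a : ℝ → ℝ) (g : ℝ → F) (t : ℝ) :
    dualTimeConv T a g t = timeConv a (fun s => g (T - s)) (T - t) := by
  have := intervalIntegral.integral_comp_sub_left (a := 0) (b := T - t)
    (fun τ => a (τ - t) • g τ) T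
  simp only [sub_sub_cancel, sub_zero] at this
  rw [dualTimeConv, timeConv, ← this]
  refine intervalIntegral.integral_congr fun s _ => ?_
  simp only [sub_right_comm]

variable {X : Type*} [NormedAddCommGroup X] [InnerProductSpace ℝ X] [CompleteSpace X] {T : ℝ}

/-- The trilinear expression `(a ∗ p ∗ q)(T)`, with the inner product as multiplication, is
symmetric in `p` and `q`. -/
theorem integral_inner_timeConv_symm {a : ℝ → ℝ} {p q : ℝ → X} (ha : IntegrableOn a (Ioo 0 T))
    (hp : MemLp p 2 (volume.restrict (Ioo 0 T))) (hq : MemLp q 2 (volume.restrict (Ioo 0 T))) :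
    ∫ t in Ioo 0 T, inner ℝ (timeConv a p t) (q (T - t)) =
      ∫ t in Ioo 0 T, inner ℝ (timeConv a q t) (p (T - t)) := by
  set B : X →L[ℝ] X →L[ℝ] ℝ := innerSL ℝ with hB
  have hBflip : B.flip = B := by
    ext x y
    simp [hB]
  have hA := ha.integrable_indicator measurableSet_Ioo
  have key : ∀ {p q : ℝ → X}, MemLp p 2 (volume.restrict (Ioo 0 T)) →
      MemLp q 2 (volume.restrict (Ioo 0 T)) →
      ∫ t in Ioo 0 T, inner ℝ (timeConv a p t) (q (T - t)) =
        ((Ioo 0 T).indicator a ⋆[ContinuousLinearMap.lsmul ℝ ℝ, volume]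
          ((Ioo 0 T).indicator p ⋆[B, volume] (Ioo 0 T).indicator q)) T := by
    intro p q hp hq
    have hP2 := (memLp_indicator_iff_restrict measurableSet_Ioo).2 hp
    have hQ2 := (memLp_indicator_iff_restrict measurableSet_Ioo).2 hq
    have hP := (integrableOn_of_memLp_two hp).integrable_indicator measurableSet_Ioo
    have hQ := (integrableOn_of_memLp_two hq).integrable_indicator measurableSet_Ioo
    set P := (Ioo 0 T).indicator p with hPdef
    set Q := (Ioo 0 T).indicator q with hQdef
    have hPQ := hP.norm.integrable_convolution (ContinuousLinearMap.mul ℝ ℝ) hQ.norm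
    -- the convolution of two square integrable functions is bounded
    have hbdd : ∀ s, ‖((fun x => ‖P x‖) ⋆[ContinuousLinearMap.mul ℝ ℝ, volume]
        fun x => ‖Q x‖) s‖ ≤ (∫ x, ‖P x‖ ^ 2) + ∫ x, ‖Q x‖ ^ 2 := by
      intro s
      have i1 : Integrable fun x => ‖P x‖ ^ 2 := hP2.integrable_norm_pow (by norm_num)
      have i2 : Integrable fun x => ‖Q x‖ ^ 2 := hQ2.integrable_norm_pow (by norm_num)
      have e := integral_sub_left_eq_self (fun x => ‖Q x‖ ^ 2) volume s
      rw [← e, ← integral_add i1 (i2.comp_sub_left s)]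
      refine norm_integral_le_of_norm_le (i1.add (i2.comp_sub_left s))
        (Eventually.of_forall fun x => ?_)
      simp only [ContinuousLinearMap.mul_apply', norm_mul, norm_norm]
      nlinarith [sq_nonneg (‖P x‖ - ‖Q (s - x)‖), sq_nonneg (‖P x‖), sq_nonneg (‖Q (s - x)‖)]
    have hassoc := convolution_assoc (μ := volume) (ν := volume) (x₀ := T)
      (ContinuousLinearMap.lsmul ℝ ℝ) B (ContinuousLinearMap.lsmul ℝ ℝ) B
      (fun x y z => by simp [hB]) hA.aestronglyMeasurable
      hP.aestronglyMeasurable hQ.aestronglyMeasurable (hA.ae_convolution_exists _ hP)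
      (hP.norm.ae_convolution_exists _ hQ.norm) (by
        refine Integrable.mul_bdd (c := (∫ x, ‖P x‖ ^ 2) + ∫ x, ‖Q x‖ ^ 2) hA.norm
          (hPQ.comp_sub_left T).aestronglyMeasurable (Eventually.of_forall fun s => hbdd _))
    rw [← hassoc, convolution_def, ← integral_indicator measurableSet_Ioo]
    refine integral_congr_ae (Eventually.of_forall fun t => ?_)
    by_cases ht : t ∈ Ioo 0 T
    · have ht' : T - t ∈ Ioo 0 T := ⟨by linarith [ht.2], by linarith [ht.1]⟩
      simp only [indicator_of_mem ht, hQdef, indicator_of_mem ht']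
      rw [timeConv_eq_convolution a p (Ioo_subset_Icc_self ht)]
      rfl
    · have ht' : T - t ∉ Ioo 0 T := fun h => ht ⟨by linarith [h.2], by linarith [h.1]⟩
      simp only [indicator_of_notMem ht, hQdef, indicator_of_notMem ht', map_zero]
  rw [key hp hq, key hq hp, ← convolution_flip (L := B) (f := (Ioo 0 T).indicator q), hBflip]

/-- The energy inequality in terms of the dual convolution: apply
`IsPCPair.integral_inner_timeConv_ge` to `g (T - ·)`. -/
theorem IsPCPair.integral_inner_ge_dualTimeConv {k l : ℝ → ℝ} (hkl : IsPCPair k l) (hT : 0 ≤ T)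
    {g : ℝ → X} (hg : MemLp g 2 (volume.restrict (Ioo 0 T))) :
    IntegrableOn (fun t => (k (T - t) + k t) * ‖dualTimeConv T l g t‖ ^ 2) (Ioo 0 T) ∧
      1 / 2 * ∫ t in Ioo 0 T, (k (T - t) + k t) * ‖dualTimeConv T l g t‖ ^ 2 ≤
      ∫ t in Ioo 0 T, inner ℝ (timeConv l g t) (g t) := by
  have il := hkl.locallyIntegrable_l.integrableOn_Ioo T
  have hg' : MemLp (fun s => g (T - s)) 2 (volume.restrict (Ioo 0 T)) :=
    hg.comp_measurePreserving measurePreserving_sub_left_Ioo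
  obtain ⟨h1, h2⟩ := hkl.integral_inner_timeConv_ge hT hg'
  set Φ : ℝ → ℝ := fun s => (k (T - s) + k s) * ‖timeConv l (fun s => g (T - s)) s‖ ^ 2
  have e : (fun t => (k (T - t) + k t) * ‖dualTimeConv T l g t‖ ^ 2) = fun t => Φ (T - t) := by
    funext t
    simp only [Φ, dualTimeConv_eq_timeConv, sub_sub_cancel, add_comm]
  rw [e]
  refine ⟨measurePreserving_sub_left_Ioo.integrable_comp_of_integrable h1, ?_⟩
  rw [integral_comp_sub_left_Ioo Φ]
  have e2 := integral_inner_timeConv_symm il hg hg'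
  simp only [sub_sub_cancel] at e2
  rw [e2]
  have e3 : ∫ t in Ioo 0 T, inner ℝ (g (T - t)) (timeConv l (fun s => g (T - s)) t) =
      ∫ t in Ioo 0 T, inner ℝ (timeConv l (fun s => g (T - s)) t) (g (T - t)) :=
    integral_congr_ae (Eventually.of_forall fun t => real_inner_comm _ _)
  rw [e3] at h2
  linarith

end Dual

/-! ### Removing the temporal regularisation -/

section WeakForm

variable {T γ : ℝ} {k l h : ℝ → ℝ}

/-- `∂ₜ((k ∗ h) ∗ v) = γ (v - h ∗ v)` almost everywhere. -/
theorem IsPCPair.deriv_timeConv_timeConv (hkl : IsPCPair k l) (hh : IsResolventKernel γ l h)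
    {F : Type*} [NormedAddCommGroup F] [NormedSpace ℝ F] [CompleteSpace F] (hT : 0 ≤ T)
    {v : ℝ → F} (hv : IntegrableOn v (Ioo 0 T)) : ∀ᵐ t ∂(volume.restrict (Ioo 0 T)),
      deriv (timeConv (timeConv k h) v) t = γ • (v t - timeConv h v t) := by
  have ih := hh.locallyIntegrable.integrableOn_Ioo T
  have ihv := integrableOn_timeConv ih hv
  have h0 : (0 : ℝ) ∈ Icc 0 T := left_mem_Icc.2 hT
  obtain ⟨C, hC⟩ := isCompact_Icc.exists_bound_of_continuousOn (hh.continuousOn_integral T)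
  have iH : IntegrableOn (fun t => ∫ s in (0 : ℝ)..t, h s) (Ioo 0 T) :=
    (hh.continuousOn_integral T).integrableOn_Icc.mono_set Ioo_subset_Icc_self
  have hprim : ∀ t ∈ Ioo 0 T, timeConv (timeConv k h) v t =
      γ • ∫ s in (0 : ℝ)..t, (v s - timeConv h v s) := by
    intro t ht
    have ht' := Ioo_subset_Icc_self ht
    rw [timeConv_congr ht' (hkl.timeConv_resolvent_eq hh T)
      (ae_of_all _ fun s => (rfl : v s = v s))]
    have e : timeConv (yosidaKernel γ h) v t =
        γ • timeConv (fun s => 1 - ∫ r in (0 : ℝ)..s, h r) v t :=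
      timeConv_smul_left γ (fun s => 1 - ∫ r in (0 : ℝ)..s, h r) v t
    have i1 := intervalIntegrable_of_integrableOn_Ioo hv h0 ht'
    have i2 := intervalIntegrable_timeConv_of_bounded iH hv
      (fun s hs => hC s (Ioo_subset_Icc_self hs)) ht'
    rw [e, intervalIntegral.integral_sub i1 (intervalIntegrable_of_integrableOn_Ioo ihv h0 ht'),
      intervalIntegral_timeConv ih hv ht']
    simp only [timeConv, sub_smul, one_smul]
    rw [intervalIntegral.integral_sub i1 i2]
  have hd := (intervalIntegrable_of_integrableOn_Ioo (hv.sub ihv) h0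
    (right_mem_Icc.2 hT)).ae_hasDerivAt_integral
  filter_upwards [ae_restrict_of_ae hd, ae_restrict_mem measurableSet_Ioo] with t h1 ht
  have h2 := (h1 (by rw [uIcc_of_le hT]; exact Ioo_subset_Icc_self ht) 0 left_mem_uIcc).const_smul γ
  have h3 : timeConv (timeConv k h) v =ᶠ[𝓝 t]
      fun t => γ • ∫ s in (0 : ℝ)..t, (v - timeConv h v) s := by
    filter_upwards [isOpen_Ioo.mem_nhds ht] with s hs using hprim s hs
  rw [h3.deriv_eq]
  exact h2.deriv

variable {X Y : Type*} [NormedAddCommGroup X] [InnerProductSpace ℝ X] [CompleteSpace X]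
  [NormedAddCommGroup Y] [InnerProductSpace ℝ Y] [CompleteSpace Y]

/-- The regularised inequality `z - h ∗ z ≤ 0`, where
`z = ⟪ψ₁, v - l ∗ f⟫ + ⟪ψ₂, l ∗ g⟫`, implies `z ≤ 0`. -/
theorem IsPCPair.le_zero_of_regularized_le (hkl : IsPCPair k l) (hh : IsResolventKernel 1 l h)
    {v f : ℝ → X} {g : ℝ → Y} (hv : IntegrableOn v (Ioo 0 T))
    (hf : IntegrableOn f (Ioo 0 T)) (hg : IntegrableOn g (Ioo 0 T)) (ψ₁ : X) (ψ₂ : Y)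
    (hle : ∀ᵐ t ∂(volume.restrict (Ioo 0 T)),
      inner ℝ ψ₁ (v t - timeConv h v t) + inner ℝ ψ₂ (timeConv h g t) ≤
        inner ℝ ψ₁ (timeConv h f t)) :
    ∀ᵐ t ∂(volume.restrict (Ioo 0 T)),
      inner ℝ ψ₁ (v t - timeConv l f t) + inner ℝ ψ₂ (timeConv l g t) ≤ 0 := by
  have il := hkl.locallyIntegrable_l.integrableOn_Ioo T
  have ih := hh.locallyIntegrable.integrableOn_Ioo T
  have ia : IntegrableOn (fun t => inner ℝ ψ₁ (v t)) (Ioo 0 T) :=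
    (innerSL ℝ ψ₁).integrable_comp hv
  have i1 : IntegrableOn (fun t => inner ℝ ψ₁ (f t)) (Ioo 0 T) :=
    (innerSL ℝ ψ₁).integrable_comp hf
  have i2 : IntegrableOn (fun t => inner ℝ ψ₂ (g t)) (Ioo 0 T) :=
    (innerSL ℝ ψ₂).integrable_comp hg
  have iA : IntegrableOn (fun t => inner ℝ ψ₁ (f t) - inner ℝ ψ₂ (g t)) (Ioo 0 T) := i1.sub i2
  set A : ℝ → ℝ := fun t => inner ℝ ψ₁ (f t) - inner ℝ ψ₂ (g t) with hA
  have ilA := integrableOn_timeConv il iA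
  have hcomm : ∀ {a : ℝ → ℝ}, IntegrableOn a (Ioo 0 T) → ∀ᵐ t ∂(volume.restrict (Ioo 0 T)),
      timeConv a A t = inner ℝ ψ₁ (timeConv a f t) - inner ℝ ψ₂ (timeConv a g t) := by
    intro a ha
    filter_upwards [timeConv_sub_right ha i1 i2, (innerSL ℝ ψ₁).timeConv_comp_comm ha hf,
      (innerSL ℝ ψ₂).timeConv_comp_comm ha hg] with t h1 h2 h3
    simp only [innerSL_apply_apply] at h2 h3
    rw [h1, h2, h3]
  have heq : ∀ᵐ s ∂(volume.restrict (Ioo 0 T)), l s - h s = timeConv h l s := by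
    filter_upwards [ae_restrict_Ioo_of_Ioi hh.equation T] with s hs
    linarith
  have hz : ∀ᵐ t ∂(volume.restrict (Ioo 0 T)), inner ℝ ψ₁ (v t) - timeConv l A t ≤
      timeConv h (fun s => inner ℝ ψ₁ (v s) - timeConv l A s) t := by
    filter_upwards [hle, hcomm ih, timeConv_sub_right ih ia ilA, timeConv_assoc ih il iA,
      timeConv_sub_left il ih iA, (innerSL ℝ ψ₁).timeConv_comp_comm ih hv,
      ae_restrict_mem measurableSet_Ioo] with t h1 h2 h3 h4 h5 h6 ht
    have e := timeConv_congr (Ioo_subset_Icc_self ht) heq (ae_of_all _ fun s => (rfl : A s = A s))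
    simp only [innerSL_apply_apply] at h6
    rw [h3, ← h6, ← h4, ← e, h5, h2]
    rw [inner_sub_right] at h1
    linarith
  filter_upwards [nonpos_of_le_timeConv ih (ia.sub ilA) (hkl.resolvent_nonneg hh one_pos T) hz,
    hcomm il] with t h1 h2
  rw [Pi.sub_apply, h2] at h1
  rw [inner_sub_right]
  linarith

end WeakForm

/-! ### Weak subsolutions -/

section Final

variable {N : ℕ} {Ω : Set (EuclideanSpace ℝ (Fin N))}

theorem L2.integral_mul_eq_inner (p q : L2 Ω ℝ) : ∫ x in Ω, p x * q x = inner ℝ p q := by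
  rw [MeasureTheory.L2.inner_def]
  simp [mul_comm]

theorem L2.integrable_mul (p q : L2 Ω ℝ) :
    Integrable (fun x => p x * q x) (volume.restrict Ω) := by
  simpa [mul_comm] using MeasureTheory.L2.integrable_inner (𝕜 := ℝ) p q

theorem L2.integral_norm_sq (p : L2 Ω (EuclideanSpace ℝ (Fin N))) :
    ∫ x in Ω, ‖p x‖ ^ 2 = ‖p‖ ^ 2 := by
  rw [← real_inner_self_eq_norm_sq, MeasureTheory.L2.inner_def]
  simp only [real_inner_self_eq_norm_sq]

theorem secondCountableTopology_L2 {E : Type*} [NormedAddCommGroup E]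
    [TopologicalSpace.SeparableSpace E] : SecondCountableTopology (L2 Ω E) :=
  have : Fact ((2 : ℝ≥0∞) ≠ ⊤) := ⟨by simp⟩
  Lp.SecondCountableTopology

/-- The weak inequality without temporal regularisation, for a fixed test function. -/
theorem IsWeakSubsolution.ae_le_of_mem {T : ℝ} {k l : ℝ → ℝ} (hT : 0 ≤ T) (hkl : IsPCPair k l)
    {V : Set (L2 Ω ℝ × L2 Ω (EuclideanSpace ℝ (Fin N)))} {u₀ : L2 Ω ℝ} {f u : ℝ → L2 Ω ℝ}
    {w : ℝ → L2 Ω ℝ × L2 Ω (EuclideanSpace ℝ (Fin N))}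
    (hf : MemLp f 2 (volume.restrict (Ioo 0 T))) (hu : MemLp u 2 (volume.restrict (Ioo 0 T)))
    (hw : MemLp w 2 (volume.restrict (Ioo 0 T)))
    (hsub : IsWeakSubsolution T k l V u₀ f u w)
    {ψ : L2 Ω ℝ × L2 Ω (EuclideanSpace ℝ (Fin N))} (hψ : ψ ∈ V)
    (hψ0 : ∀ᵐ x ∂(volume.restrict Ω), 0 ≤ ψ.1 x) :
    ∀ᵐ t ∂(volume.restrict (Ioo 0 T)),
      inner ℝ ψ.1 ((u t - u₀) - timeConv l f t) +
        inner ℝ ψ.2 (timeConv l (fun τ => (w τ).2) t) ≤ 0 := by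
  obtain ⟨h, hh⟩ := exists_isResolventKernel hkl.locallyIntegrable_l ((1 : ℕ) : ℝ)
  have hh1 : IsResolventKernel 1 l h := by simpa using hh
  have iu : IntegrableOn (fun τ => u τ - u₀) (Ioo 0 T) :=
    (integrableOn_of_memLp_two hu).sub (integrableOn_Ioo_const u₀)
  have iw : IntegrableOn (fun τ => (w τ).2) (Ioo 0 T) := (integrableOn_of_memLp_two hw).snd
  refine hkl.le_zero_of_regularized_le hh1 iu (integrableOn_of_memLp_two hf) iw ψ.1 ψ.2 ?_
  filter_upwards [hsub 1 le_rfl h hh ψ hψ hψ0, hkl.deriv_timeConv_timeConv hh1 hT iu] with t h1 h2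
  rw [h2, one_smul, integral_add (L2.integrable_mul _ _)
    (MeasureTheory.L2.integrable_inner (𝕜 := ℝ) _ _), L2.integral_mul_eq_inner,
    L2.integral_mul_eq_inner, ← MeasureTheory.L2.inner_def] at h1
  rwa [real_inner_comm ψ.2, real_inner_comm ψ.1 (timeConv h f t)] at h1

/-- The weak inequality without temporal regularisation, tested with `w(t)` at almost every time:
the exceptional set is chosen for a countable dense set of test functions, and the inequality is
stable under limits. -/
theorem IsWeakSubsolution.ae_le {T : ℝ} {k l : ℝ → ℝ} (hT : 0 ≤ T) (hkl : IsPCPair k l)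
    {V : Set (L2 Ω ℝ × L2 Ω (EuclideanSpace ℝ (Fin N)))} {u₀ : L2 Ω ℝ} {f u : ℝ → L2 Ω ℝ}
    {w : ℝ → L2 Ω ℝ × L2 Ω (EuclideanSpace ℝ (Fin N))}
    (hf : MemLp f 2 (volume.restrict (Ioo 0 T))) (hu : MemLp u 2 (volume.restrict (Ioo 0 T)))
    (hw : MemL2Time T V w)
    (hw0 : ∀ᵐ t ∂(volume.restrict (Ioo 0 T)), ∀ᵐ x ∂(volume.restrict Ω), 0 ≤ (w t).1 x)
    (hsub : IsWeakSubsolution T k l V u₀ f u w) :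
    ∀ᵐ t ∂(volume.restrict (Ioo 0 T)),
      inner ℝ (w t).1 ((u t - u₀) - timeConv l f t) +
        inner ℝ (w t).2 (timeConv l (fun τ => (w τ).2) t) ≤ 0 := by
  have := secondCountableTopology_L2 (Ω := Ω) (E := ℝ)
  have := secondCountableTopology_L2 (Ω := Ω) (E := EuclideanSpace ℝ (Fin N))
  -- the admissible test functions form a separable metric space
  set S := {ψ ∈ V | ∀ᵐ x ∂(volume.restrict Ω), 0 ≤ ψ.1 x}
  obtain ⟨D, hDc, hDd⟩ := TopologicalSpace.exists_countable_dense S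
  have hD : ∀ᵐ t ∂(volume.restrict (Ioo 0 T)), ∀ ψ ∈ D,
      inner ℝ ψ.1.1 ((u t - u₀) - timeConv l f t) +
        inner ℝ ψ.1.2 (timeConv l (fun τ => (w τ).2) t) ≤ 0 :=
    (ae_ball_iff hDc).2 fun ψ _ => hsub.ae_le_of_mem hT hkl hf hu hw.1 ψ.2.1 ψ.2.2
  filter_upwards [hD, hw.2, hw0] with t h1 h2 h3
  have hcl : IsClosed {ψ : S | inner ℝ ψ.1.1 ((u t - u₀) - timeConv l f t) +
      inner ℝ ψ.1.2 (timeConv l (fun τ => (w τ).2) t) ≤ 0} :=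
    isClosed_le (by fun_prop) continuous_const
  have huniv := hcl.closure_subset_iff.2 h1
  exact huniv (hDd.closure_eq ▸ mem_univ (⟨w t, h2, h3⟩ : S))

end Final

theorem mainTheorem3 {N : ℕ} (Ω : Set (EuclideanSpace ℝ (Fin N)))
    (hΩ_open : IsOpen Ω) (hΩ_bdd : Bornology.IsBounded Ω)
    (T : ℝ) (hT : 0 < T) (k l : ℝ → ℝ) (hkl : IsPCPair k l) (bc : BoundaryCondition)
    (u₀ : L2 Ω ℝ) (f u : ℝ → L2 Ω ℝ)
    (w : ℝ → L2 Ω ℝ × L2 Ω (EuclideanSpace ℝ (Fin N)))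
    (hf : MemLp f 2 (volume.restrict (Ioo 0 T)))
    (hu : MemLp u 2 (volume.restrict (Ioo 0 T)))
    (hku : ConvContinuousVanishing T k u)
    (hw : MemL2Time T (bc.space Ω) w)
    (hw_nonneg : ∀ᵐ t ∂(volume.restrict (Ioo 0 T)), ∀ᵐ x ∂(volume.restrict Ω), 0 ≤ (w t).1 x)
    (hsub : IsWeakSubsolution T k l (bc.space Ω) u₀ f u w) :
    IntegrableOn (fun t => ∫ x in Ω,
        (k (T - t) + k t) * ‖dualTimeConv T l (fun τ => (w τ).2) t x‖ ^ 2) (Ioo 0 T) ∧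
    (∫ t in Ioo 0 T, ∫ x in Ω, (w t).1 x * u t x)
        + 1 / 2 * ∫ t in Ioo 0 T, ∫ x in Ω,
            (k (T - t) + k t) * ‖dualTimeConv T l (fun τ => (w τ).2) t x‖ ^ 2
      ≤ ∫ t in Ioo 0 T, ∫ x in Ω, (u₀ x + timeConv l f t x) * (w t).1 x := by
  have il := hkl.locallyIntegrable_l.integrableOn_Ioo T
  have hw1 : MemLp (fun t => (w t).1) 2 (volume.restrict (Ioo 0 T)) := hw.1.fst
  have hw2 : MemLp (fun t => (w t).2) 2 (volume.restrict (Ioo 0 T)) := hw.1.snd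
  obtain ⟨hint, henergy⟩ := hkl.integral_inner_ge_dualTimeConv hT.le hw2
  simp only [integral_const_mul, L2.integral_norm_sq]
  refine ⟨hint, ?_⟩
  have hlf := memLp_timeConv il hf
  have hu₀ : MemLp (fun _ : ℝ => u₀) 2 (volume.restrict (Ioo 0 T)) := memLp_const u₀
  have hlw := memLp_timeConv il hw2
  have e : ∀ t, ∫ x in Ω, (u₀ x + timeConv l f t x) * (w t).1 x =
      inner ℝ u₀ (w t).1 + inner ℝ (timeConv l f t) (w t).1 := fun t => by
    simp only [add_mul]
    rw [integral_add (L2.integrable_mul _ _) (L2.integrable_mul _ _), L2.integral_mul_eq_inner,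
      L2.integral_mul_eq_inner]
  simp only [e, L2.integral_mul_eq_inner]
  have hle : ∫ t in Ioo 0 T, (inner ℝ (w t).1 (u t) +
      inner ℝ (timeConv l (fun τ => (w τ).2) t) (w t).2) ≤
      ∫ t in Ioo 0 T, (inner ℝ u₀ (w t).1 + inner ℝ (timeConv l f t) (w t).1) := by
    refine integral_mono_ae ((integrableOn_inner hw1 hu).add (integrableOn_inner hlw hw2))
      ((integrableOn_inner hu₀ hw1).add (integrableOn_inner hlf hw1)) ?_
    filter_upwards [hsub.ae_le hT.le hkl hf hu hw hw_nonneg] with t ht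
    rw [inner_sub_right, inner_sub_right, real_inner_comm u₀, real_inner_comm (timeConv l f t),
      real_inner_comm (timeConv l (fun τ => (w τ).2) t)] at ht
    linarith
  rw [integral_add (integrableOn_inner hw1 hu) (integrableOn_inner hlw hw2)] at hle
  linarith
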